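/- Let $m\ge 2$, and let $f:[-1,1]^2\to\mathbb{R}$ be a continuous function such that the kernel $K((x,z),(y,w))=f(x\cdot y,z\cdot w)$ on $S^1\times S^m$ is positive definite, i.e. $\sum_{\mu,\nu=1}^n c_\mu c_\nu K(\xi_\mu,\xi_\nu)\ge 0$ for all $n\ge1$, all distinct points $\xi_1,\dots,\xi_n\in S^1\times S^m$ and all real $c_1,\dots,c_n$. Here $S^d$ is the unit sphere of $\mathbb{R}^{d+1}$ and $\cdot$ is the usual inner product. The kernel is called strictly positive definite if in addition these inequalities are strict whenever $(c_1,\dots,c_n)\ne 0$. For $l\ge 0$ let $P_l^m$ be the Gegenbauer polynomial of degree $l$ with parameter $(m-1)/2$, normalized by $P_l^m(1)=\binom{l+m-2}{l}$, and let $P_0^1=1$ and $P_k^1(\cos\theta)=\frac2k\cos k\theta$ for $k\ge1$. Then $f$ has a representation $$f(t,s)=\sum_{k,l=0}^\infty a_{k,l}P_k^1(t)P_l^m(s),\qquad t,s\in[-1,1],$$ with $a_{k,l}\ge 0$ and $\sum_{k,l}a_{k,l}P_k^1(1)P_l^m(1)<\infty$. For any such representation put $f_l(t)=\sum_{k=0}^\infty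 a_{k,l}P_k^1(t)$, so that $f(t,s)=\sum_{l=0}^\infty f_l(t)P_l^m(s)$. The following assertions are equivalent: (i) the kernel $((x,z),(y,w))\mapsto f(x\cdot y,z\cdot w)$ on $S^1\times S^m$ is strictly positive definite; (ii) for every positive integer $p$, all distinct points $x_1,\dots,x_p\in S^1$ and every $c\in\mathbb{R}^p\setminus\{0\}$, the set $$\Big\{l\ge 0:\ a_{k,l}>0\text{ for some }k,\ \text{ and }\ c^t\,[f_l(x_i\cdot x_j)]_{i,j=1}^p\,c>0\Big\}$$ contains infinitely many even and infinitely many odd integers. -/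

import Mathlib

open scoped Polynomial

noncomputable section

/-- The unit sphere `S^m` of `ℝ^(m+1)`. -/
abbrev UnitSphere (m : ℕ) : Type :=
  Metric.sphere (0 : EuclideanSpace ℝ (Fin (m + 1))) 1

/-- The usual inner product `x · y` of two points of `S^m`. -/
def sphereDot {m : ℕ} (x y : UnitSphere m) : ℝ :=
  inner ℝ (x : EuclideanSpace ℝ (Fin (m + 1))) (y : EuclideanSpace ℝ (Fin (m + 1)))

/-- A real kernel `K` on `X` is positive definite: it is symmetric, and
`∑ c_μ c_ν K(x_μ, x_ν) ≥ 0` for finitely many distinct points and real scalars. -/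
def IsPosDefKernel {X : Type*} (K : X → X → ℝ) : Prop :=
  (∀ x y, K x y = K y x) ∧
    ∀ n : ℕ, 0 < n → ∀ x : Fin n → X, Function.Injective x → ∀ c : Fin n → ℝ,
      0 ≤ ∑ μ, ∑ ν, c μ * c ν * K (x μ) (x ν)

/-- A positive definite kernel is strictly positive definite if the inequalities are strict
whenever at least one of the scalars is nonzero. -/
def IsStrictlyPosDefKernel {X : Type*} (K : X → X → ℝ) : Prop :=
  IsPosDefKernel K ∧
    ∀ n : ℕ, 0 < n → ∀ x : Fin n → X, Function.Injective x → ∀ c : Fin n → ℝ, c ≠ 0 →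
      0 < ∑ μ, ∑ ν, c μ * c ν * K (x μ) (x ν)

/-- The isotropic kernel `((x,z),(y,w)) ↦ f(x · y, z · w)` on `S^1 × S^m` generated by `f`. -/
def circleSphereKernel (m : ℕ) (f : ℝ → ℝ → ℝ) :
    UnitSphere 1 × UnitSphere m → UnitSphere 1 × UnitSphere m → ℝ :=
  fun ξ η => f (sphereDot ξ.1 η.1) (sphereDot ξ.2 η.2)

/-- The Gegenbauer (ultraspherical) polynomials `C_n^α`, by their three-term recurrence
`(n+2) C_{n+2} = 2 (n+1+α) X C_{n+1} - (n+2α) C_n`, `C_0 = 1`, `C_1 = 2αX`. -/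
def gegenbauerPoly (α : ℝ) : ℕ → ℝ[X]
  | 0 => 1
  | 1 => Polynomial.C (2 * α) * Polynomial.X
  | n + 2 =>
      Polynomial.C (1 / ((n : ℝ) + 2)) *
        (Polynomial.C (2 * ((n : ℝ) + 1 + α)) * Polynomial.X * gegenbauerPoly α (n + 1)
          - Polynomial.C ((n : ℝ) + 2 * α) * gegenbauerPoly α n)

/-- `P_l^m` for `m ≥ 2`: the Gegenbauer polynomial of degree `l` attached to `(m-1)/2`, so that
`P_l^m(1) = (l+m-2 choose l)`. -/
def spherePoly (m l : ℕ) : ℝ[X] := gegenbauerPoly (((m : ℝ) - 1) / 2) l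

/-- `P_k^1`: `P_0^1 = 1` and `P_k^1(cos θ) = (2/k) cos(kθ)` for `k ≥ 1`. -/
def circlePoly (k : ℕ) : ℝ[X] :=
  if k = 0 then 1 else Polynomial.C (2 / (k : ℝ)) * Polynomial.Chebyshev.T ℝ (k : ℤ)

/-- `a` is the family of coefficients of a representation
`f(t,s) = ∑_{k,l} a_{k,l} P_k^1(t) P_l^m(s)`, `t, s ∈ [-1,1]`, with `a_{k,l} ≥ 0` and
`∑_{k,l} a_{k,l} P_k^1(1) P_l^m(1) < ∞`. -/
def IsDoubleGegenbauerSeries (m : ℕ) (f : ℝ → ℝ → ℝ) (a : ℕ → ℕ → ℝ) : Prop :=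
  (∀ k l, 0 ≤ a k l) ∧
  (Summable fun kl : ℕ × ℕ =>
    a kl.1 kl.2 * (circlePoly kl.1).eval 1 * (spherePoly m kl.2).eval 1) ∧
  ∀ t ∈ Set.Icc (-1 : ℝ) 1, ∀ s ∈ Set.Icc (-1 : ℝ) 1,
    HasSum (fun kl : ℕ × ℕ =>
      a kl.1 kl.2 * (circlePoly kl.1).eval t * (spherePoly m kl.2).eval s) (f t s)

/-- `f_l(t) = ∑_k a_{k,l} P_k^1(t)`. -/
def circlePart (a : ℕ → ℕ → ℝ) (l : ℕ) (t : ℝ) : ℝ :=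
  ∑' k : ℕ, a k l * (circlePoly k).eval t

/-- The set of those `l`, with some `a_{k,l} > 0`, for which
`cᵗ [f_l(x_i · x_j)] c > 0`. -/
def positiveLevels (a : ℕ → ℕ → ℝ) {p : ℕ} (x : Fin p → UnitSphere 1) (c : Fin p → ℝ) : Set ℕ :=
  {l | (∃ k, 0 < a k l) ∧
    0 < c ⬝ᵥ (Matrix.of fun i j => circlePart a l (sphereDot (x i) (x j))).mulVec c}

end

/-! Existence of the series is Schoenberg's theorem for a product of two spheres. Write Z_n for the
zonal polynomial of S^d with Z_n(1) = 1. Its kernel Z_n(x·y) is a finite sum of squares of features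
(`exists_zonalPoly_sphere_features`), so multiplying by it preserves positive semidefiniteness. The
products Z_k(t) Z_l(s) are orthogonal for the distribution of the pair of inner products with a base
point. The coefficients of f are nonnegative because the integral of a continuous positive
semidefinite kernel is. They are summable because integrating f against powers of (1+t)(1+s), which
peak only at (1,1), bounds every partial sum by f(1,1) (`exists_orthogonal_expansion`).

For the equivalence, the quadratic form of the kernel is the sum over l of its degree-l parts
(`levelForm`), all nonnegative, so it is positive exactly when some level is.

(i) ⇒ (ii): place the points x_i against a regular 2M-gon on a great circle of S^m, with weights c_i
(-1)^j. Each level factors as the form of f_l at c times an alternating form of Z_l. Since Z_l(cos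
θ) only involves cos kθ with k ≤ l and k ≡ l mod 2, the second factor vanishes unless l ≥ M and l ≡
M mod 2 (`sum_alternating_zonalPoly_eq_zero`). Strict positivity thus forces a positive level of the
parity of M beyond any bound.

(ii) ⇒ (i): write each point of S^m as a sign times an antipodal representative. Distinct
representatives have inner product in (-1,1), where Z_l tends to 0 because m ≥ 2
(`tendsto_eval_zonalPoly`). For large l the matrix of Z_l at the representatives is almost the
identity, so the level form dominates half of one diagonal block (`IsPSDKernel.half_block_le`). In
that block antipodal points merge with sign (±1)^l; for at least one parity of l the merged
coefficients do not all vanish, and (ii) supplies a large positive level of that parity. -/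

open Filter Topology

noncomputable section

/-! ### Zonal polynomials and their normalizations -/

/-- The zonal polynomials of the sphere `S^d`: the Gegenbauer polynomials with parameter
`(d-1)/2`, normalized to take the value `1` at `1` (Chebyshev polynomials if `d = 1`). -/
def zonalPoly (d : ℕ) : ℕ → ℝ[X]
  | 0 => 1
  | 1 => Polynomial.X
  | n + 2 =>
      Polynomial.C (1 / ((n : ℝ) + d)) *
        (Polynomial.C (2 * (n : ℝ) + 1 + d) * Polynomial.X * zonalPoly d (n + 1)
          - Polynomial.C ((n : ℝ) + 1) * zonalPoly d n)

theorem zonalPoly_recurrence {d : ℕ} (hd : 1 ≤ d) (n : ℕ) :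
    Polynomial.C ((n : ℝ) + d) * zonalPoly d (n + 2) =
      Polynomial.C (2 * (n : ℝ) + 1 + d) * Polynomial.X * zonalPoly d (n + 1)
          - Polynomial.C ((n : ℝ) + 1) * zonalPoly d n := by
  have h : ((n : ℝ) + d) ≠ 0 := by positivity
  rw [zonalPoly, ← mul_assoc, ← Polynomial.C_mul, mul_one_div_cancel h, Polynomial.C_1, one_mul]

theorem eval_zonalPoly_recurrence {d : ℕ} (hd : 1 ≤ d) (n : ℕ) (t : ℝ) :
    ((n : ℝ) + d) * (zonalPoly d (n + 2)).eval t =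
      (2 * (n : ℝ) + 1 + d) * t * (zonalPoly d (n + 1)).eval t
          - ((n : ℝ) + 1) * (zonalPoly d n).eval t := by
  simpa using congrArg (Polynomial.eval t) (zonalPoly_recurrence hd n)

theorem eval_one_zonalPoly {d : ℕ} (hd : 1 ≤ d) (n : ℕ) : (zonalPoly d n).eval 1 = 1 := by
  induction n using Nat.twoStepInduction with
  | zero => simp [zonalPoly]
  | one => simp [zonalPoly]
  | more n h0 h1 =>
    have h := eval_zonalPoly_recurrence hd n 1
    have hn : ((n : ℝ) + d) ≠ 0 := by positivity
    apply mul_left_cancel₀ hn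
    rw [h, h0, h1]; ring

theorem eval_neg_zonalPoly {d : ℕ} (hd : 1 ≤ d) (n : ℕ) (t : ℝ) :
    (zonalPoly d n).eval (-t) = (-1) ^ n * (zonalPoly d n).eval t := by
  induction n using Nat.twoStepInduction with
  | zero => simp [zonalPoly]
  | one => simp [zonalPoly]
  | more n h0 h1 =>
    have hn : ((n : ℝ) + d) ≠ 0 := by positivity
    apply mul_left_cancel₀ hn
    rw [eval_zonalPoly_recurrence hd n (-t), h0, h1]
    linear_combination (-(-1) ^ n) * eval_zonalPoly_recurrence hd n t

/-- Solving the recurrence for X Z_{n+1} shows that the span is stable under multiplication by X,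
and it contains 1. -/
theorem span_range_zonalPoly {d : ℕ} (hd : 1 ≤ d) :
    Submodule.span ℝ (Set.range (zonalPoly d)) = ⊤ := by
  have hX : ∀ p ∈ Submodule.span ℝ (Set.range (zonalPoly d)),
      Polynomial.X * p ∈ Submodule.span ℝ (Set.range (zonalPoly d)) := by
    intro p hp
    induction hp using Submodule.span_induction with
    | mem p hp =>
      obtain ⟨n, rfl⟩ := hp
      rcases n with _ | n
      · have : Polynomial.X * zonalPoly d 0 = zonalPoly d 1 := by simp [zonalPoly]
        rw [this]
        exact Submodule.subset_span ⟨1, rfl⟩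
      · have h : ((2 : ℝ) * n + 1 + d) ≠ 0 := by positivity
        have : Polynomial.X * zonalPoly d (n + 1) =
            (((n : ℝ) + d) / (2 * n + 1 + d)) • zonalPoly d (n + 2) +
            (((n : ℝ) + 1) / (2 * n + 1 + d)) • zonalPoly d n := by
          have hC : Polynomial.C ((2 : ℝ) * n + 1 + d) ≠ 0 := Polynomial.C_ne_zero.2 h
          apply mul_left_cancel₀ hC
          have h1 := zonalPoly_recurrence hd n
          rw [mul_add, Polynomial.smul_eq_C_mul, Polynomial.smul_eq_C_mul, ← mul_assoc,
            ← mul_assoc, ← mul_assoc, ← Polynomial.C_mul, ← Polynomial.C_mul,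
            mul_div_cancel₀ _ h, mul_div_cancel₀ _ h, h1]
          ring
        rw [this]
        exact Submodule.add_mem _ (Submodule.smul_mem _ _ (Submodule.subset_span ⟨_, rfl⟩))
          (Submodule.smul_mem _ _ (Submodule.subset_span ⟨_, rfl⟩))
    | zero => simp
    | add p q _ _ h1 h2 => rw [mul_add]; exact Submodule.add_mem _ h1 h2
    | smul a p _ h => rw [mul_smul_comm]; exact Submodule.smul_mem _ _ h
  rw [eq_top_iff]
  intro p _
  have hpow : ∀ n : ℕ, (Polynomial.X ^ n : ℝ[X]) ∈ Submodule.span ℝ (Set.range (zonalPoly d)) := by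
    intro n
    induction n with
    | zero => exact Submodule.subset_span ⟨0, by simp [zonalPoly]⟩
    | succ n ih => rw [pow_succ']; exact hX _ ih
  induction p using Polynomial.induction_on' with
  | add p q hp hq => exact Submodule.add_mem _ (hp trivial) (hq trivial)
  | monomial n a =>
    rw [← Polynomial.C_mul_X_pow_eq_monomial, ← Polynomial.smul_eq_C_mul]
    exact Submodule.smul_mem _ _ (hpow n)

/-- The value of `C_n^α` at `1`. -/
def gegenbauerValue (α : ℝ) (n : ℕ) : ℝ := ∏ i ∈ Finset.range n, ((i : ℝ) + 2 * α) / (i + 1)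

theorem gegenbauerValue_pos {α : ℝ} (hα : 0 < α) (n : ℕ) : 0 < gegenbauerValue α n :=
  Finset.prod_pos fun i _ => by positivity

theorem gegenbauerValue_sphere_pos {m : ℕ} (hm : 2 ≤ m) (l : ℕ) :
    0 < gegenbauerValue (((m : ℝ) - 1) / 2) l := by
  have : (2 : ℝ) ≤ m := by exact_mod_cast hm
  exact gegenbauerValue_pos (by linarith) l

/-- The Gegenbauer recurrence, divided by the values at 1, becomes the zonal one; the ratio of
consecutive values at 1 is (n + 2α)/(n + 1). -/
theorem spherePoly_eq {m : ℕ} (hm : 2 ≤ m) (l : ℕ) :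
    spherePoly m l =
      Polynomial.C (gegenbauerValue (((m : ℝ) - 1) / 2) l) * zonalPoly m l := by
  unfold spherePoly
  induction l using Nat.twoStepInduction with
  | zero => simp [gegenbauerPoly, zonalPoly, gegenbauerValue]
  | one => simp [gegenbauerPoly, zonalPoly, gegenbauerValue]
  | more n h0 h1 =>
    have hn : ((n : ℝ) + 2) ≠ 0 := by positivity
    have hn1 : ((n : ℝ) + 1) ≠ 0 := by positivity
    have hnm : ((n : ℝ) + m) ≠ 0 := by positivity
    set α : ℝ := ((m : ℝ) - 1) / 2 with hα
    have hv1 : ((n : ℝ) + 1) * gegenbauerValue α (n + 1) =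
        ((n : ℝ) + 2 * α) * gegenbauerValue α n := by
      rw [gegenbauerValue, Finset.prod_range_succ, ← gegenbauerValue]
      field_simp
    have hv2 : gegenbauerValue α (n + 2) =
        gegenbauerValue α (n + 1) * (((n : ℝ) + m) / (n + 2)) := by
      rw [gegenbauerValue, Finset.prod_range_succ, ← gegenbauerValue]
      push_cast
      congr 2
      · rw [hα]; ring
      · ring
    rw [gegenbauerPoly, h0, h1, hv2]
    apply Polynomial.funext
    intro t
    have hr := eval_zonalPoly_recurrence (show 1 ≤ m by omega) n t
    simp only [Polynomial.eval_mul, Polynomial.eval_C, Polynomial.eval_sub, Polynomial.eval_X]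
    rw [div_eq_mul_inv ((n : ℝ) + m), mul_assoc (gegenbauerValue α (n + 1)),
      mul_right_comm ((n : ℝ) + m), hr]
    have : 2 * α = m - 1 := by rw [hα]; ring
    have h3 : ((n : ℝ) + 2 * α) * (gegenbauerValue α n * (zonalPoly m n).eval t) =
      ((n : ℝ) + 1) * gegenbauerValue α (n + 1) * (zonalPoly m n).eval t := by
      rw [hv1]; ring
    rw [h3]
    have h4 : 2 * ((n : ℝ) + 1 + α) = 2 * n + 1 + m := by linarith
    rw [h4]
    field_simp

theorem chebyshev_T_eq_zonalPoly (k : ℕ) : Polynomial.Chebyshev.T ℝ (k : ℤ) = zonalPoly 1 k := by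
  induction k using Nat.twoStepInduction with
  | zero => simp [zonalPoly]
  | one => simp [zonalPoly]
  | more n h0 h1 =>
    have hn : ((n : ℝ) + 1) ≠ 0 := by positivity
    have h := Polynomial.Chebyshev.T_add_two ℝ (n : ℤ)
    push_cast at h h1 ⊢
    rw [h, h0, h1]
    apply Polynomial.funext
    intro t
    apply mul_left_cancel₀ hn
    have := eval_zonalPoly_recurrence (le_refl 1) n t
    push_cast at this
    rw [this]
    simp only [Polynomial.eval_mul, Polynomial.eval_sub, Polynomial.eval_X, Polynomial.eval_ofNat]
    ring

/-- The value of `P_k^1` at `1`. -/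
def circleValue (k : ℕ) : ℝ := if k = 0 then 1 else 2 / (k : ℝ)

theorem circleValue_pos (k : ℕ) : 0 < circleValue k := by
  unfold circleValue
  split_ifs with h
  · norm_num
  · have : 0 < k := Nat.pos_of_ne_zero h
    positivity

theorem circlePoly_eq (k : ℕ) : circlePoly k = Polynomial.C (circleValue k) * zonalPoly 1 k := by
  unfold circlePoly circleValue
  split_ifs with h
  · simp [h, zonalPoly]
  · rw [chebyshev_T_eq_zonalPoly]

/-! ### Decay of zonal polynomials inside (-1,1) -/

/-- A limit L > 0 would make each two-step decrement at least cL/(n+b). The decrements telescope to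
at most E 0 + E 1, while the harmonic series diverges. -/
theorem tendsto_zero_of_antitone_of_harmonic_decay {E : ℕ → ℝ} (h0 : ∀ n, 0 ≤ E n)
    (hE : ∀ n, E (n + 1) ≤ E n) {c b : ℝ} (hc : 0 < c) (hb : 0 < b)
    (h : ∀ n : ℕ, c / (n + b) * E (n + 2) ≤ E n - E (n + 2)) : Tendsto E atTop (𝓝 0) := by
  have hanti : Antitone E := antitone_nat_of_succ_le hE
  obtain ⟨L, hL⟩ : ∃ L, Tendsto E atTop (𝓝 L) :=
    ⟨_, tendsto_atTop_ciInf hanti ⟨0, by rintro _ ⟨n, rfl⟩; exact h0 n⟩⟩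
  have hL0 : 0 ≤ L := ge_of_tendsto' hL h0
  have hLE : ∀ n, L ≤ E n := fun n => hanti.le_of_tendsto hL n
  rcases hL0.eq_or_lt with hL0 | hL0
  · rwa [← hL0] at hL
  exfalso
  have hsum : ∀ N, ∑ n ∈ Finset.range N, c / ((n : ℝ) + b) * L ≤ E 0 + E 1 := by
    intro N
    have h1 : ∀ N, ∑ n ∈ Finset.range N, (E n - E (n + 2)) = E 0 + E 1 - E N - E (N + 1) := by
      intro N
      induction N with
      | zero => simp
      | succ N ih => rw [Finset.sum_range_succ, ih]; ring
    calc _ ≤ ∑ n ∈ Finset.range N, (E n - E (n + 2)) := by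
          refine Finset.sum_le_sum fun n _ => le_trans ?_ (h n)
          have := hLE (n + 2)
          gcongr
      _ ≤ _ := by rw [h1]; linarith [h0 N, h0 (N + 1)]
  have hs : Summable fun n : ℕ => c / ((n : ℝ) + b) * L :=
    summable_of_sum_range_le (fun n => by positivity) hsum
  obtain ⟨B, hB⟩ := exists_nat_gt b
  have hs2 : Summable fun n : ℕ => 1 / (((n + B : ℕ)) : ℝ) := by
    refine Summable.of_nonneg_of_le (fun n => by positivity) (fun n => ?_)
      (hs.mul_left (1 / (c * L)))
    have : 1 / (c * L) * (c / ((n : ℝ) + b) * L) = 1 / ((n : ℝ) + b) := by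
      field_simp
    rw [this]
    push_cast
    gcongr
  exact Real.not_summable_one_div_natCast ((summable_nat_add_iff B).1 hs2)

/-- The recurrence is a rotation damped by δ_n = (d-1)/(n+d). The energy E, conserved for d = 1,
loses a proportion of order 1/n once d ≥ 2, and 1/n is not summable. -/
theorem tendsto_eval_zonalPoly {d : ℕ} (hd : 2 ≤ d) {t : ℝ} (ht : |t| < 1) :
    Tendsto (fun n => (zonalPoly d n).eval t) atTop (𝓝 0) := by
  have ht2 : 0 < 1 - t ^ 2 := by
    have := (sq_lt_one_iff_abs_lt_one t).2 ht
    linarith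
  have ht0 : 0 ≤ t ^ 2 := sq_nonneg t
  set G : ℕ → ℝ := fun n => (zonalPoly d n).eval t with hG
  set E : ℕ → ℝ := fun n => (G (n + 1) - t * G n) ^ 2 + (1 - t ^ 2) * G n ^ 2 with hEdef
  set q : ℕ → ℝ := fun n => (G n - t * G (n + 1)) ^ 2 with hq
  set δ : ℕ → ℝ := fun n => ((d : ℝ) - 1) / (n + d) with hδ
  have hd1 : (1 : ℝ) ≤ (d : ℝ) - 1 := by
    have : (2 : ℝ) ≤ d := by exact_mod_cast hd
    linarith
  have hδ0 : ∀ n, 0 ≤ δ n := fun n => by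
    have : 0 ≤ (d : ℝ) - 1 := by linarith
    simp only [hδ]; positivity
  have hδ1 : ∀ n, δ n ≤ 1 := fun n => by
    simp only [hδ]
    rw [div_le_one (by positivity)]
    have : (0 : ℝ) ≤ n := by positivity
    linarith
  have hrec : ∀ n, G (n + 2) = t * G (n + 1) + (1 - δ n) * (t * G (n + 1) - G n) := by
    intro n
    have h := eval_zonalPoly_recurrence (show 1 ≤ d by omega) n t
    have hn : ((n : ℝ) + d) ≠ 0 := by positivity
    apply mul_left_cancel₀ hn
    simp only [hG, hδ] at *
    rw [h]
    field_simp
    ring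
  -- Both E n and E (n+1) are written through q n and G (n+1), so that one step only contracts the q
  -- term by (1 - δ n)².
  have hE0 : ∀ n, E n = q n + (1 - t ^ 2) * G (n + 1) ^ 2 := fun n => by
    simp only [hEdef, hq]; ring
  have hE1 : ∀ n, E (n + 1) = (1 - δ n) ^ 2 * q n + (1 - t ^ 2) * G (n + 1) ^ 2 := fun n => by
    simp only [hEdef, hq, hrec]; ring
  have hq0 : ∀ n, 0 ≤ q n := fun n => sq_nonneg _
  have hEn : ∀ n, 0 ≤ E n := fun n => by rw [hE0]; have := hq0 n; positivity
  have hdiff : ∀ n, δ n * q n ≤ E n - E (n + 1) := fun n => by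
    rw [hE0, hE1]
    nlinarith [mul_nonneg (mul_nonneg (hδ0 n) (hq0 n)) (sub_nonneg.2 (hδ1 n))]
  have hmono : ∀ n, E (n + 1) ≤ E n := fun n => by
    nlinarith [hdiff n, mul_nonneg (hδ0 n) (hq0 n)]
  -- A single q n may vanish, but two consecutive ones control the energy: (1 - t²) G (n+1) is a
  -- bounded combination of their square roots.
  have hkey : ∀ n, (1 - t ^ 2) * E (n + 1) ≤ 3 * (q n + q (n + 1)) := by
    intro n
    have h1 : (1 - t ^ 2) * G (n + 1) = (G (n + 1) - t * G (n + 2)) +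
        t * (1 - δ n) * (t * G (n + 1) - G n) := by rw [hrec n]; ring
    have h2 : ((1 - t ^ 2) * G (n + 1)) ^ 2 ≤ 2 * q (n + 1) + 2 * q n := by
      rw [h1]
      have h3 : (t * (1 - δ n) * (t * G (n + 1) - G n)) ^ 2 ≤ q n := by
        have : (t * (1 - δ n) * (t * G (n + 1) - G n)) ^ 2 = t ^ 2 * (1 - δ n) ^ 2 * q n := by
          simp only [hq]; ring
        rw [this]
        have h4 : t ^ 2 * (1 - δ n) ^ 2 ≤ 1 := by
          have : (1 - δ n) ^ 2 ≤ 1 := by nlinarith [hδ0 n, hδ1 n]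
          nlinarith
        nlinarith [hq0 n]
      have h5 : q (n + 1) = (G (n + 1) - t * G (n + 2)) ^ 2 := rfl
      nlinarith [sq_nonneg ((G (n + 1) - t * G (n + 2)) - t * (1 - δ n) * (t * G (n + 1) - G n))]
    have h6 : (1 - t ^ 2) * E (n + 1) =
        (1 - t ^ 2) * ((1 - δ n) ^ 2 * q n) + ((1 - t ^ 2) * G (n + 1)) ^ 2 := by
      rw [hE1]; ring
    have h7 : (1 - t ^ 2) * ((1 - δ n) ^ 2 * q n) ≤ q n := by
      have h8 : (1 - δ n) ^ 2 * q n ≤ q n := by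
        have : (1 - δ n) ^ 2 ≤ 1 := by nlinarith [hδ0 n, hδ1 n]
        nlinarith [hq0 n]
      have : 0 ≤ (1 - δ n) ^ 2 * q n := mul_nonneg (sq_nonneg _) (hq0 n)
      nlinarith
    linarith [hq0 (n + 1)]
  have hElim : Tendsto E atTop (𝓝 0) := by
    -- The 3 comes from `hkey`, and b = d + 1 from δ (n+1) ≥ 1/(n+d+1), which uses d - 1 ≥ 1.
    refine tendsto_zero_of_antitone_of_harmonic_decay hEn hmono
      (c := (1 - t ^ 2) / 3) (b := d + 1) (by positivity) (by positivity) fun n => ?_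
    have hδle : 1 / ((n : ℝ) + (d + 1)) ≤ δ (n + 1) := by
      simp only [hδ]; push_cast
      rw [show (n : ℝ) + 1 + d = n + (d + 1) by ring]
      gcongr
    have hδle' : δ (n + 1) ≤ δ n := by
      have : 0 ≤ (d : ℝ) - 1 := by linarith
      simp only [hδ]; push_cast
      gcongr
      linarith
    have h1 := hdiff n
    have h2 := hdiff (n + 1)
    have h3 : δ (n + 1) * q n ≤ δ n * q n := mul_le_mul_of_nonneg_right hδle' (hq0 n)
    have h4 := hkey n
    have h5 : (1 - t ^ 2) * E (n + 2) ≤ (1 - t ^ 2) * E (n + 1) :=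
      mul_le_mul_of_nonneg_left (hmono (n + 1)) ht2.le
    have h6 : 1 / ((n : ℝ) + (d + 1)) * (q n + q (n + 1)) ≤ δ (n + 1) * (q n + q (n + 1)) :=
      mul_le_mul_of_nonneg_right hδle (add_nonneg (hq0 _) (hq0 _))
    have h7 : (1 - t ^ 2) / 3 / (n + (d + 1)) * E (n + 2) =
      1 / ((n : ℝ) + (d + 1)) * ((1 - t ^ 2) * E (n + 2) / 3) := by ring
    rw [h7]
    have h8 : 1 / ((n : ℝ) + (d + 1)) * ((1 - t ^ 2) * E (n + 2) / 3) ≤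
        1 / ((n : ℝ) + (d + 1)) * (q n + q (n + 1)) := by
      apply mul_le_mul_of_nonneg_left _ (by positivity)
      linarith
    linarith
  have hsq : Tendsto (fun n => G n ^ 2) atTop (𝓝 0) := by
    refine squeeze_zero (fun n => sq_nonneg _) (fun n => ?_)
      (by simpa using hElim.div_const (1 - t ^ 2))
    rw [le_div_iff₀ ht2]
    simp only [hEdef]
    nlinarith [sq_nonneg (G (n + 1) - t * G n)]
  have := (Real.continuous_sqrt.tendsto 0).comp hsq
  rw [Real.sqrt_zero] at this
  refine (tendsto_zero_iff_abs_tendsto_zero _).2 (this.congr fun n => ?_)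
  simp [Real.sqrt_sq_eq_abs]

/-! ### Harmonic homogeneous extensions of zonal polynomials -/

namespace MvPolynomial

variable {ι : Type*}

/-- The commutator of two derivations is a derivation, and this one kills every variable. -/
theorem pderiv_pderiv_comm (i j : ι) (p : MvPolynomial ι ℝ) :
    pderiv i (pderiv j p) = pderiv j (pderiv i p) := by
  classical
  have h : ⁅(pderiv i : Derivation ℝ (MvPolynomial ι ℝ) (MvPolynomial ι ℝ)),
      (pderiv j : Derivation ℝ (MvPolynomial ι ℝ) (MvPolynomial ι ℝ))⁆ = 0 := by
    apply MvPolynomial.derivation_ext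
    intro k
    rw [Derivation.commutator_apply, pderiv_X, pderiv_X, Pi.single_apply, Pi.single_apply]
    split_ifs <;> simp
  have := DFunLike.congr_fun h p
  rw [Derivation.commutator_apply] at this
  exact sub_eq_zero.1 this

variable [Fintype ι]

/-- The linear form `x ↦ ∑ w_i x_i`. -/
def linForm (w : ι → ℝ) : MvPolynomial ι ℝ := ∑ i, C (w i) * X i

/-- The quadratic form `x ↦ ∑ x_i²`. -/
def normSqPoly (ι : Type*) [Fintype ι] : MvPolynomial ι ℝ := ∑ i, X i * X i

/-- The derivative in the direction `w`. -/
def dirDeriv (w : ι → ℝ) (p : MvPolynomial ι ℝ) : MvPolynomial ι ℝ := ∑ i, C (w i) * pderiv i p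

/-- The Laplace operator on polynomials. -/
def laplace (p : MvPolynomial ι ℝ) : MvPolynomial ι ℝ := ∑ i, pderiv i (pderiv i p)

theorem isHomogeneous_linForm (w : ι → ℝ) : (linForm w).IsHomogeneous 1 :=
  IsHomogeneous.sum _ _ _ fun _ _ => isHomogeneous_C_mul_X _ _

theorem isHomogeneous_normSqPoly : (normSqPoly ι).IsHomogeneous 2 :=
  IsHomogeneous.sum _ _ _ fun _ _ => (isHomogeneous_X _ _).mul (isHomogeneous_X _ _)

theorem dirDeriv_mul (w : ι → ℝ) (p q : MvPolynomial ι ℝ) :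
    dirDeriv w (p * q) = dirDeriv w p * q + p * dirDeriv w q := by
  simp only [dirDeriv, pderiv_mul, Finset.sum_mul, Finset.mul_sum, ← Finset.sum_add_distrib]
  exact Finset.sum_congr rfl fun i _ => by ring

theorem dirDeriv_sub (w : ι → ℝ) (p q : MvPolynomial ι ℝ) :
    dirDeriv w (p - q) = dirDeriv w p - dirDeriv w q := by
  simp only [dirDeriv, map_sub, mul_sub, Finset.sum_sub_distrib]

theorem dirDeriv_C_mul (w : ι → ℝ) (a : ℝ) (p : MvPolynomial ι ℝ) :
    dirDeriv w (C a * p) = C a * dirDeriv w p := by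
  simp only [dirDeriv, pderiv_C_mul, Finset.mul_sum]
  exact Finset.sum_congr rfl fun i _ => by ring

theorem pderiv_linForm (w : ι → ℝ) (i : ι) : pderiv i (linForm w) = C (w i) := by
  classical
  simp [linForm, pderiv_X, Pi.single_apply]

theorem pderiv_normSqPoly (i : ι) : pderiv i (normSqPoly ι) = C 2 * X i := by
  classical
  have : (C 2 : MvPolynomial ι ℝ) = 2 := rfl
  simp [normSqPoly, pderiv_X, Pi.single_apply, Finset.sum_add_distrib, this]
  ring

theorem dirDeriv_linForm (w : ι → ℝ) : dirDeriv w (linForm w) = C (∑ i, w i ^ 2) := by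
  simp only [dirDeriv, pderiv_linForm, map_sum]
  exact Finset.sum_congr rfl fun i _ => by rw [← C_mul, sq]

theorem dirDeriv_normSqPoly (w : ι → ℝ) : dirDeriv w (normSqPoly ι) = C 2 * linForm w := by
  simp only [dirDeriv, pderiv_normSqPoly, linForm, Finset.mul_sum]
  exact Finset.sum_congr rfl fun i _ => by ring

theorem laplace_sub (p q : MvPolynomial ι ℝ) : laplace (p - q) = laplace p - laplace q := by
  simp only [laplace, map_sub, Finset.sum_sub_distrib]

theorem laplace_C_mul (a : ℝ) (p : MvPolynomial ι ℝ) : laplace (C a * p) = C a * laplace p := by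
  simp only [laplace, pderiv_C_mul, Finset.mul_sum]

theorem laplace_linForm_mul (w : ι → ℝ) (p : MvPolynomial ι ℝ) :
    laplace (linForm w * p) = linForm w * laplace p + C 2 * dirDeriv w p := by
  have : (C 2 : MvPolynomial ι ℝ) = 2 := rfl
  simp only [laplace, dirDeriv, pderiv_mul, pderiv_linForm, map_add, pderiv_C, Finset.mul_sum,
    ← Finset.sum_add_distrib, this]
  exact Finset.sum_congr rfl fun i _ => by ring

/-- The cross term of the product rule is 4 ∑ x_i ∂_i p, which Euler's identity turns into 4np. -/
theorem laplace_normSqPoly_mul {p : MvPolynomial ι ℝ} {n : ℕ} (hp : p.IsHomogeneous n) :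
    laplace (normSqPoly ι * p) =
      normSqPoly ι * laplace p + C (4 * (n : ℝ) + 2 * Fintype.card ι) * p := by
  have h2 : (C 2 : MvPolynomial ι ℝ) = 2 := rfl
  have heuler := hp.sum_X_mul_pderiv
  have h1 : ∀ i, pderiv i (pderiv i (normSqPoly ι * p)) =
      normSqPoly ι * pderiv i (pderiv i p) + 4 * (X i * pderiv i p) + 2 * p := by
    intro i
    simp only [pderiv_mul, pderiv_normSqPoly, map_add, pderiv_C, pderiv_X_self]
    rw [h2]
    ring
  simp only [laplace, h1, Finset.sum_add_distrib, ← Finset.mul_sum, heuler]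
  have h4 : (C (4 * (n : ℝ) + 2 * Fintype.card ι) : MvPolynomial ι ℝ) =
      4 * (n : MvPolynomial ι ℝ) + 2 * (Fintype.card ι : MvPolynomial ι ℝ) := by
    simp only [C_add, C_mul, map_natCast]; rfl
  rw [h4]
  simp
  ring

theorem laplace_dirDeriv (w : ι → ℝ) (p : MvPolynomial ι ℝ) :
    laplace (dirDeriv w p) = dirDeriv w (laplace p) := by
  simp only [laplace, dirDeriv, map_sum, pderiv_C_mul, Finset.mul_sum]
  rw [Finset.sum_comm]
  refine Finset.sum_congr rfl fun i _ => Finset.sum_congr rfl fun j _ => ?_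
  rw [pderiv_pderiv_comm j i, pderiv_pderiv_comm j i]

theorem isHomogeneous_dirDeriv (w : ι → ℝ) {p : MvPolynomial ι ℝ} {n : ℕ}
    (hp : p.IsHomogeneous (n + 1)) : (dirDeriv w p).IsHomogeneous n :=
  IsHomogeneous.sum _ _ _ fun i _ => by simpa using (isHomogeneous_C ι (w i)).mul hp.pderiv

theorem eval_dirDeriv_self (w : ι → ℝ) {p : MvPolynomial ι ℝ} {n : ℕ}
    (hp : p.IsHomogeneous n) : eval w (dirDeriv w p) = n * eval w p := by
  have := congrArg (eval w) hp.sum_X_mul_pderiv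
  simpa [dirDeriv] using this

/-- The homogeneous extension of `x ↦ Z_n(x · w)` for a unit vector `w`,
`Z_n` being the zonal polynomials of `S^d`. -/
def zonalMv (d : ℕ) (w : ι → ℝ) : ℕ → MvPolynomial ι ℝ
  | 0 => 1
  | 1 => linForm w
  | n + 2 =>
      C (1 / ((n : ℝ) + d)) *
        (C (2 * (n : ℝ) + 1 + d) * (linForm w * zonalMv d w (n + 1))
          - C ((n : ℝ) + 1) * (normSqPoly ι * zonalMv d w n))

theorem isHomogeneous_zonalMv (d : ℕ) (w : ι → ℝ) (n : ℕ) :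
    (zonalMv d w n).IsHomogeneous n := by
  induction n using Nat.twoStepInduction with
  | zero => exact isHomogeneous_one _ _
  | one => exact isHomogeneous_linForm w
  | more n h0 h1 =>
    rw [zonalMv]
    have e1 : 0 + (0 + (1 + (n + 1))) = n + 2 := by ring
    have e2 : 0 + (0 + (2 + n)) = n + 2 := by ring
    have a := (isHomogeneous_C ι (1 / ((n : ℝ) + d))).mul
      ((isHomogeneous_C ι (2 * (n : ℝ) + 1 + d)).mul ((isHomogeneous_linForm w).mul h1))
    have b := (isHomogeneous_C ι (1 / ((n : ℝ) + d))).mul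
      ((isHomogeneous_C ι ((n : ℝ) + 1)).mul (isHomogeneous_normSqPoly.mul h0))
    rw [mul_sub]
    rw [e1] at a
    rw [e2] at b
    exact a.sub b

theorem eval_zonalMv (d : ℕ) (w x : ι → ℝ) (hx : ∑ i, x i ^ 2 = 1) (n : ℕ) :
    eval x (zonalMv d w n) = (zonalPoly d n).eval (∑ i, w i * x i) := by
  have hN : eval x (normSqPoly ι) = 1 := by simp [normSqPoly, ← hx, sq]
  have hL : eval x (linForm w) = ∑ i, w i * x i := by simp [linForm]
  induction n using Nat.twoStepInduction with
  | zero => simp [zonalMv, zonalPoly]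
  | one => simp [zonalMv, zonalPoly, hL]
  | more n h0 h1 =>
    simp only [zonalMv, zonalPoly, eval_mul, eval_C, eval_sub, h0, h1, hN, hL,
      Polynomial.eval_mul, Polynomial.eval_C, Polynomial.eval_sub, Polynomial.eval_X]
    ring

/-- Differentiating the recurrence along the unit vector w sends the linear form to 1 and |x|² to
twice the linear form. The recurrence one degree lower then collects the remaining terms. -/
theorem dirDeriv_zonalMv {d : ℕ} (hd : 1 ≤ d) {w : ι → ℝ} (hw : ∑ i, w i ^ 2 = 1) (n : ℕ) :
    dirDeriv w (zonalMv d w (n + 1)) = C ((n : ℝ) + 1) * zonalMv d w n := by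
  have h2 : (C 2 : MvPolynomial ι ℝ) = 2 := rfl
  have hone : dirDeriv w 1 = 0 := by simp [dirDeriv]
  induction n using Nat.twoStepInduction with
  | zero => simp [zonalMv, dirDeriv_linForm, hw]
  | one =>
    have h : ((d : ℝ)) ≠ 0 := by positivity
    have hc : (C (1 / (d : ℝ)) : MvPolynomial ι ℝ) * C (d : ℝ) = 1 := by
      rw [← C_mul, one_div_mul_cancel h, C_1]
    rw [show 1 + 1 = 0 + 2 from rfl, zonalMv.eq_3, dirDeriv_C_mul, dirDeriv_sub, dirDeriv_C_mul,
      dirDeriv_C_mul, dirDeriv_mul, dirDeriv_mul]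
    simp only [zonalMv, hone, dirDeriv_linForm, hw,
      dirDeriv_normSqPoly, C_1, h2, Nat.cast_zero, Nat.cast_one, zero_add, C_add, mul_zero]
    linear_combination (2 * linForm w) * hc
  | more n h0 h1 =>
    have hr : (C ((n : ℝ) + d) : MvPolynomial ι ℝ) * zonalMv d w (n + 2) =
        C (2 * (n : ℝ) + 1 + d) * (linForm w * zonalMv d w (n + 1))
          - C ((n : ℝ) + 1) * (normSqPoly ι * zonalMv d w n) := by
      have h : ((n : ℝ) + d) ≠ 0 := by positivity
      rw [zonalMv, ← mul_assoc, ← C_mul, mul_one_div_cancel h, C_1, one_mul]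
    have h3 : ((n : ℝ) + 1 + d) ≠ 0 := by positivity
    have hc : (C (1 / ((n : ℝ) + 1 + d)) : MvPolynomial ι ℝ) * C ((n : ℝ) + 1 + d) = 1 := by
      rw [← C_mul, one_div_mul_cancel h3, C_1]
    rw [zonalMv, dirDeriv_C_mul, dirDeriv_sub, dirDeriv_C_mul, dirDeriv_C_mul, dirDeriv_mul,
      dirDeriv_mul, h0, h1, dirDeriv_linForm, hw, dirDeriv_normSqPoly]
    push_cast
    simp only [C_add, C_mul, C_1, map_natCast, h2] at hr hc ⊢
    linear_combination ((n : MvPolynomial ι ℝ) + 3) * zonalMv d w (n + 2) * hc -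
      (C (1 / ((n : ℝ) + 1 + d)) : MvPolynomial ι ℝ) * ((n : MvPolynomial ι ℝ) + 2) * hr

/-- In the recurrence the linear form contributes 2(2n+1+d)(n+1) Z_n and |x|² contributes
(n+1)(4n+2(d+1)) Z_n; these cancel exactly in d + 1 variables. -/
theorem laplace_zonalMv {d : ℕ} (hd : 1 ≤ d) (hcard : Fintype.card ι = d + 1) {w : ι → ℝ}
    (hw : ∑ i, w i ^ 2 = 1) (n : ℕ) : laplace (zonalMv d w n) = 0 := by
  have h2 : (C 2 : MvPolynomial ι ℝ) = 2 := rfl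
  have h4 : (C 4 : MvPolynomial ι ℝ) = 4 := rfl
  induction n using Nat.twoStepInduction with
  | zero => simp [zonalMv, laplace]
  | one => simp [zonalMv, laplace, pderiv_linForm]
  | more n h0 h1 =>
    rw [zonalMv, laplace_C_mul, laplace_sub, laplace_C_mul, laplace_C_mul, laplace_linForm_mul,
      laplace_normSqPoly_mul (isHomogeneous_zonalMv d w n), h0, h1, dirDeriv_zonalMv hd hw, hcard]
    push_cast
    simp only [C_add, C_mul, C_1, map_natCast, h2, h4]
    ring

end MvPolynomial

/-! ### Fischer inner product and feature maps of zonal kernels -/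

namespace MvPolynomial

open scoped Nat

variable {ι : Type*} [Fintype ι]

/-- The Fischer inner product `⟨p, q⟩ = ∑ α! p_α q_α`, as a linear functional of `p`. -/
def fischer (q : MvPolynomial ι ℝ) : MvPolynomial ι ℝ →ₗ[ℝ] ℝ :=
  (basisMonomials ι ℝ).constr ℝ fun α => ((∏ i, (α i)! : ℕ) : ℝ) * coeff α q

theorem fischer_monomial (q : MvPolynomial ι ℝ) (α : ι →₀ ℕ) (c : ℝ) :
    fischer q (monomial α c) = c * (((∏ i, (α i)! : ℕ) : ℝ) * coeff α q) := by
  have h : monomial α c = c • basisMonomials ι ℝ α := by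
    simp [coe_basisMonomials, smul_monomial]
  rw [h, map_smul, fischer, Module.Basis.constr_basis, smul_eq_mul]

theorem fischer_eq_sum {p : MvPolynomial ι ℝ} {S : Finset (ι →₀ ℕ)} (hS : p.support ⊆ S)
    (q : MvPolynomial ι ℝ) :
    fischer q p = ∑ α ∈ S, ((∏ i, (α i)! : ℕ) : ℝ) * (coeff α p * coeff α q) := by
  conv_lhs => rw [p.as_sum]
  rw [map_sum]
  simp only [fischer_monomial]
  rw [Finset.sum_subset hS]
  · exact Finset.sum_congr rfl fun α _ => by ring
  · intro α _ hα
    rw [notMem_support_iff.1 hα]; ring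

theorem IsHomogeneous.eval_mul_left {p : MvPolynomial ι ℝ} {n : ℕ} (hp : p.IsHomogeneous n)
    (c : ℝ) (x : ι → ℝ) : eval (fun i => c * x i) p = c ^ n * eval x p := by
  rw [eval_eq', eval_eq', Finset.mul_sum]
  refine Finset.sum_congr rfl fun α hα => ?_
  have h : ∑ i, α i = n := by
    by_contra hne
    exact mem_support_iff.1 hα (hp.coeff_eq_zero (by rwa [Finsupp.degree_eq_sum]))
  simp only [mul_pow]
  rw [Finset.prod_mul_distrib, Finset.prod_pow_eq_pow_sum, h]
  ring

/-- Multiplication by a variable is adjoint to differentiation: the weights satisfy (α_i + 1)! =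
(α_i + 1) α_i!. -/
theorem fischer_X_mul (q p : MvPolynomial ι ℝ) (i : ι) :
    fischer q (X i * p) = fischer (pderiv i q) p := by
  classical
  induction p using MvPolynomial.induction_on' with
  | add p p' hp hp' => rw [mul_add, map_add, map_add, hp, hp']
  | monomial α c =>
    rw [X, monomial_mul, one_mul, fischer_monomial, fischer_monomial, coeff_pderiv,
      add_comm (Finsupp.single i 1)]
    have : (∏ j, ((α + Finsupp.single i 1 : ι →₀ ℕ) j)! : ℕ) = (α i + 1) * ∏ j, (α j)! := by
      rw [← Finset.mul_prod_erase _ _ (Finset.mem_univ i),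
        ← Finset.mul_prod_erase _ (fun j => (α j)!) (Finset.mem_univ i), ← mul_assoc]
      congr 1
      · simp [Nat.factorial_succ]
      · refine Finset.prod_congr rfl fun j hj => ?_
        rw [Finsupp.add_apply, Finsupp.single_eq_of_ne (Finset.ne_of_mem_erase hj), add_zero]
    rw [this]
    push_cast
    ring

theorem fischer_sum_C_mul (r : ι → ℝ) (q : ι → MvPolynomial ι ℝ) (p : MvPolynomial ι ℝ) :
    fischer (∑ i, C (r i) * q i) p = ∑ i, r i * fischer (q i) p := by
  simp only [fischer_eq_sum (Finset.Subset.refl p.support), coeff_sum, coeff_C_mul, Finset.mul_sum]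
  rw [Finset.sum_comm]
  exact Finset.sum_congr rfl fun _ _ => Finset.sum_congr rfl fun _ _ => by ring

theorem fischer_linForm_mul (w : ι → ℝ) (q p : MvPolynomial ι ℝ) :
    fischer q (linForm w * p) = fischer (dirDeriv w q) p := by
  rw [dirDeriv, fischer_sum_C_mul, linForm, Finset.sum_mul, map_sum]
  refine Finset.sum_congr rfl fun i _ => ?_
  rw [mul_assoc, ← smul_eq_C_mul, map_smul, fischer_X_mul, smul_eq_mul]

theorem fischer_normSqPoly_mul (q p : MvPolynomial ι ℝ) :
    fischer q (normSqPoly ι * p) = fischer (laplace q) p := by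
  have h : laplace q = ∑ i : ι, C (1 : ℝ) * pderiv i (pderiv i q) := by simp [laplace]
  rw [h, fischer_sum_C_mul, normSqPoly, Finset.sum_mul, map_sum]
  refine Finset.sum_congr rfl fun i _ => ?_
  rw [mul_assoc, fischer_X_mul, fischer_X_mul, one_mul]

/-- The zonal polynomials reproduce the harmonic homogeneous polynomials
with respect to the Fischer inner product. -/
theorem exists_fischer_zonalMv {d : ℕ} (hd : 1 ≤ d) (n : ℕ) :
    ∃ κ : ℝ, 0 < κ ∧ ∀ (w : ι → ℝ) (q : MvPolynomial ι ℝ), q.IsHomogeneous n →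
      laplace q = 0 → fischer q (zonalMv d w n) = κ * eval w q := by
  have h0 : ∀ (w : ι → ℝ) (q : MvPolynomial ι ℝ), q.IsHomogeneous 0 → fischer q 1 = eval w q := by
    intro w q hq
    obtain ⟨a, rfl⟩ : ∃ a, q = C a :=
      ⟨_, totalDegree_eq_zero_iff_eq_C.1 ((totalDegree_zero_iff_isHomogeneous _).2 hq)⟩
    rw [show (1 : MvPolynomial ι ℝ) = monomial 0 1 from rfl, fischer_monomial]
    simp
  have hlap : ∀ (w : ι → ℝ) (q : MvPolynomial ι ℝ), laplace q = 0 → laplace (dirDeriv w q) = 0 := by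
    intro w q hq
    rw [laplace_dirDeriv, hq]; simp [dirDeriv]
  induction n with
  | zero => exact ⟨1, one_pos, fun w q hq _ => by rw [zonalMv, h0 w q hq, one_mul]⟩
  | succ n ih =>
    obtain ⟨κ, hκ, ih⟩ := ih
    rcases n with _ | n
    · refine ⟨1, one_pos, fun w q hq _ => ?_⟩
      rw [zonalMv, ← mul_one (linForm w), fischer_linForm_mul,
        h0 w _ (isHomogeneous_dirDeriv w hq), eval_dirDeriv_self w hq]
      simp
    -- Passing to adjoints in the recurrence, the |x|² term meets Δq = 0 and drops. The linear form
    -- becomes ∂_w q, whose value at w is (n+2) q(w) by Euler.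
    · refine ⟨1 / ((n : ℝ) + d) * ((2 * (n : ℝ) + 1 + d) * (κ * ((n + 1 + 1 : ℕ) : ℝ))),
        by positivity, fun w q hq hq0 => ?_⟩
      rw [zonalMv, ← smul_eq_C_mul, ← smul_eq_C_mul, ← smul_eq_C_mul, map_smul, map_sub, map_smul,
        map_smul, fischer_linForm_mul, fischer_normSqPoly_mul, hq0,
        ih w _ (isHomogeneous_dirDeriv w hq) (hlap w q hq0), eval_dirDeriv_self w hq]
      have : fischer (0 : MvPolynomial ι ℝ) (zonalMv d w n) = 0 := by
        rw [fischer_eq_sum (Finset.Subset.refl _)]; simp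
      rw [this]
      simp only [smul_eq_mul]
      ring

/-- Pairing the extensions for u and w gives κ Z_n(u·w) by the reproducing property. The Fischer
product is diagonal in monomials with positive weights, so weighted coefficients serve as features.
-/
theorem exists_zonalPoly_features {d : ℕ} (hd : 1 ≤ d) (hcard : Fintype.card ι = d + 1) (n : ℕ) :
    ∃ (S : Finset (ι →₀ ℕ)) (ψ : (ι →₀ ℕ) → (ι → ℝ) → ℝ), ∀ u w : ι → ℝ,
      ∑ i, u i ^ 2 = 1 → ∑ i, w i ^ 2 = 1 →
        (zonalPoly d n).eval (∑ i, u i * w i) = ∑ α ∈ S, ψ α u * ψ α w := by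
  classical
  obtain ⟨κ, hκ, h⟩ := exists_fischer_zonalMv (ι := ι) hd n
  refine ⟨Finset.finsuppAntidiag Finset.univ n,
    fun α u => √(((∏ i, (α i)! : ℕ) : ℝ) / κ) * coeff α (zonalMv d u n), fun u w hu hw => ?_⟩
  have hsupp : (zonalMv d w n).support ⊆ Finset.finsuppAntidiag Finset.univ n := by
    intro α hα
    rw [Finset.mem_finsuppAntidiag]
    refine ⟨?_, Finset.subset_univ _⟩
    by_contra hne
    refine mem_support_iff.1 hα ((isHomogeneous_zonalMv d w n).coeff_eq_zero ?_)
    rwa [Finsupp.degree_eq_sum]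
  have h1 := h w _ (isHomogeneous_zonalMv d u n) (laplace_zonalMv hd hcard hu n)
  rw [eval_zonalMv d u w hw, fischer_eq_sum hsupp] at h1
  rw [← mul_right_inj' hκ.ne', ← h1, Finset.mul_sum]
  refine Finset.sum_congr rfl fun α _ => ?_
  have h2 : √(((∏ i, (α i)! : ℕ) : ℝ) / κ) * √(((∏ i, (α i)! : ℕ) : ℝ) / κ) =
      ((∏ i, (α i)! : ℕ) : ℝ) / κ := Real.mul_self_sqrt (by positivity)
  calc _ = κ * (((∏ i, (α i)! : ℕ) : ℝ) / κ) * (coeff α (zonalMv d w n) *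
        coeff α (zonalMv d u n)) := by rw [mul_div_cancel₀ _ hκ.ne']
    _ = _ := by rw [← h2]; ring

end MvPolynomial

/-! ### Gaussian integration and orthogonality on the sphere -/

open MeasureTheory

/-- The moments of the weight `exp(-x²/2)`. -/
def gaussMoment (n : ℕ) : ℝ := ∫ x : ℝ, x ^ n * Real.exp (-(1 / 2) * x ^ 2)

theorem integrable_pow_mul_gauss (n : ℕ) :
    Integrable fun x : ℝ => x ^ n * Real.exp (-(1 / 2) * x ^ 2) := by
  have := integrable_rpow_mul_exp_neg_mul_sq (b := 1 / 2) (by norm_num) (s := n)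
    (by have : (0 : ℝ) ≤ n := by positivity
        linarith)
  simpa [Real.rpow_natCast] using this

/-- Integration by parts. For n = 0 the truncated index n - 1 is harmless, as its factor is 0. -/
theorem gaussMoment_succ (n : ℕ) : gaussMoment (n + 1) = n * gaussMoment (n - 1) := by
  have hv : ∀ x : ℝ, HasDerivAt (fun x : ℝ => Real.exp (-(1 / 2) * x ^ 2))
      (-x * Real.exp (-(1 / 2) * x ^ 2)) x := by
    intro x
    refine (((hasDerivAt_pow 2 x).const_mul (-(1 / 2) : ℝ)).exp).congr_deriv ?_
    push_cast
    ring
  have h := integral_mul_deriv_eq_deriv_mul_of_integrable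
    (u := fun x : ℝ => x ^ n) (u' := fun x : ℝ => n * x ^ (n - 1))
    (v := fun x : ℝ => Real.exp (-(1 / 2) * x ^ 2))
    (v' := fun x : ℝ => -x * Real.exp (-(1 / 2) * x ^ 2))
    (fun x _ => hasDerivAt_pow n x)
    (fun x _ => hv x)
    ((integrable_pow_mul_gauss (n + 1)).neg.congr (ae_of_all _ fun x => by simp; ring))
    (((integrable_pow_mul_gauss (n - 1)).const_mul (n : ℝ)).congr
      (ae_of_all _ fun x => by simp [mul_assoc]))
    (integrable_pow_mul_gauss n)
  have h1 : ∫ x : ℝ, x ^ n * (-x * Real.exp (-(1 / 2) * x ^ 2)) = -gaussMoment (n + 1) := by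
    rw [gaussMoment, ← integral_neg]
    exact integral_congr_ae (ae_of_all _ fun x => by simp; ring)
  have h2 : ∫ x : ℝ, n * x ^ (n - 1) * Real.exp (-(1 / 2) * x ^ 2) = n * gaussMoment (n - 1) := by
    rw [gaussMoment, ← integral_const_mul]
    exact integral_congr_ae (ae_of_all _ fun x => by simp [mul_assoc])
  rw [h1, h2] at h
  linarith

namespace MvPolynomial

variable {ι : Type*} [Fintype ι]

/-- Integration of polynomials against the weight `exp(-|x|²/2)`. -/
def gaussInt : MvPolynomial ι ℝ →ₗ[ℝ] ℝ :=
  (basisMonomials ι ℝ).constr ℝ fun α => ∏ i, gaussMoment (α i)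

theorem gaussInt_monomial (α : ι →₀ ℕ) (c : ℝ) :
    gaussInt (monomial α c) = c * ∏ i, gaussMoment (α i) := by
  have h : monomial α c = c • basisMonomials ι ℝ α := by
    simp [coe_basisMonomials, smul_monomial]
  rw [h, map_smul, gaussInt, Module.Basis.constr_basis, smul_eq_mul]

theorem gaussInt_X_mul (p : MvPolynomial ι ℝ) (i : ι) :
    gaussInt (X i * p) = gaussInt (pderiv i p) := by
  classical
  induction p using MvPolynomial.induction_on' with
  | add p q hp hq => rw [mul_add, map_add, map_add, map_add, hp, hq]
  | monomial α c =>
    rw [X, monomial_mul, one_mul, pderiv_monomial, gaussInt_monomial, gaussInt_monomial,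
      ← Finset.mul_prod_erase _ (fun j => gaussMoment ((Finsupp.single i 1 + α : ι →₀ ℕ) j))
        (Finset.mem_univ i),
      ← Finset.mul_prod_erase _ (fun j => gaussMoment ((α - Finsupp.single i 1 : ι →₀ ℕ) j))
        (Finset.mem_univ i)]
    have h1 : ∏ j ∈ Finset.univ.erase i, gaussMoment ((Finsupp.single i 1 + α : ι →₀ ℕ) j) =
        ∏ j ∈ Finset.univ.erase i, gaussMoment ((α - Finsupp.single i 1 : ι →₀ ℕ) j) := by
      refine Finset.prod_congr rfl fun j hj => ?_
      have := Finset.ne_of_mem_erase hj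
      simp [Finsupp.single_eq_of_ne this]
    rw [h1]
    have h2 : (Finsupp.single i 1 + α : ι →₀ ℕ) i = α i + 1 := by simp [add_comm]
    have h3 : (α - Finsupp.single i 1 : ι →₀ ℕ) i = α i - 1 := by simp
    rw [h2, h3, gaussMoment_succ]
    ring

/-- By Euler's identity, integration by parts and harmonicity, k∫pq = ∑ ∫ ∂_i p ∂_i q. The right
side is symmetric in p and q, so k∫pq = l∫pq. -/
theorem gaussInt_mul_eq_zero {p q : MvPolynomial ι ℝ} {k l : ℕ} (hkl : k ≠ l)
    (hp : p.IsHomogeneous k) (hq : q.IsHomogeneous l) (hp0 : laplace p = 0)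
    (hq0 : laplace q = 0) : gaussInt (p * q) = 0 := by
  have key : ∀ (p q : MvPolynomial ι ℝ) (k : ℕ), p.IsHomogeneous k → laplace p = 0 →
      (k : ℝ) * gaussInt (p * q) = ∑ i, gaussInt (pderiv i p * pderiv i q) := by
    intro p q k hp hp0
    have h1 : (k : ℝ) * gaussInt (p * q) = gaussInt ((k • p) * q) := by
      rw [← smul_eq_mul, ← map_smul, nsmul_eq_mul, smul_eq_C_mul, map_natCast, mul_assoc]
    rw [h1, ← hp.sum_X_mul_pderiv, Finset.sum_mul, map_sum]
    have h2 : ∀ i, gaussInt (X i * pderiv i p * q) =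
        gaussInt (pderiv i (pderiv i p) * q) + gaussInt (pderiv i p * pderiv i q) := by
      intro i
      rw [mul_assoc, gaussInt_X_mul, pderiv_mul, map_add]
    simp only [h2, Finset.sum_add_distrib]
    rw [← map_sum, ← Finset.sum_mul, ← laplace, hp0, zero_mul, map_zero, zero_add]
  have h1 := key p q k hp hp0
  have h2 := key q p l hq hq0
  simp only [mul_comm q p, mul_comm (pderiv _ q) (pderiv _ p)] at h2
  rw [← h1] at h2
  have h3 : ((k : ℝ) - l) * gaussInt (p * q) = 0 := by linarith
  rcases mul_eq_zero.1 h3 with h | h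
  · exact absurd (by exact_mod_cast sub_eq_zero.1 h) hkl
  · exact h

theorem integrable_and_integral_gauss (p : MvPolynomial ι ℝ) :
    (Integrable fun x : ι → ℝ => eval x p * Real.exp (-(1 / 2) * ∑ i, x i ^ 2)) ∧
      ∫ x : ι → ℝ, eval x p * Real.exp (-(1 / 2) * ∑ i, x i ^ 2) = gaussInt p := by
  induction p using MvPolynomial.induction_on' with
  | add p q hp hq =>
    simp only [map_add, add_mul]
    exact ⟨hp.1.add hq.1, by rw [integral_add hp.1 hq.1, hp.2, hq.2]⟩
  | monomial α c =>
    have h : ∀ x : ι → ℝ, eval x (monomial α c) * Real.exp (-(1 / 2) * ∑ i, x i ^ 2) =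
        c * ∏ i, (x i ^ α i * Real.exp (-(1 / 2) * x i ^ 2)) := by
      intro x
      rw [eval_monomial, Finset.mul_sum, Real.exp_sum, Finset.prod_mul_distrib, mul_assoc,
        Finsupp.prod_fintype _ _ (by simp)]
    simp only [h]
    refine ⟨(Integrable.fintype_prod fun i => integrable_pow_mul_gauss (α i)).const_mul c, ?_⟩
    rw [integral_const_mul, gaussInt_monomial,
      integral_fintype_prod_volume_eq_prod (fun i x => x ^ α i * Real.exp (-(1 / 2) * x ^ 2))]
    rfl

end MvPolynomial

/-- The surface measure of `S^d`. -/
def sphereMeasure (d : ℕ) : Measure (UnitSphere d) :=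
  (volume : Measure (EuclideanSpace ℝ (Fin (d + 1)))).toSphere

instance (d : ℕ) : IsFiniteMeasure (sphereMeasure d) := by
  unfold sphereMeasure; infer_instance

instance (d : ℕ) : (sphereMeasure d).IsOpenPosMeasure := by
  unfold sphereMeasure; infer_instance

/-- In polar coordinates the Gaussian integral of a homogeneous polynomial is its sphere integral
times ∫ r^(n+d) exp(-r²/2) dr, a positive Gamma value. -/
theorem integral_sphere_eq_zero_of_gaussInt {d n : ℕ} {p : MvPolynomial (Fin (d + 1)) ℝ}
    (hp : p.IsHomogeneous n) (h0 : p.gaussInt = 0) :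
    ∫ x : UnitSphere d, MvPolynomial.eval (fun i => x.1 i) p ∂sphereMeasure d = 0 := by
  set E := EuclideanSpace ℝ (Fin (d + 1))
  set g : E → ℝ := fun x => MvPolynomial.eval (fun i => x i) p * Real.exp (-(1 / 2) * ‖x‖ ^ 2)
  have h1 : ∫ x : E, g x = 0 := by
    rw [← h0, ← (MvPolynomial.integrable_and_integral_gauss p).2,
      ← (PiLp.volume_preserving_toLp (Fin (d + 1))).integral_comp
        (MeasurableEquiv.toLp 2 _).measurableEmbedding]
    refine integral_congr_ae (ae_of_all _ fun x => ?_)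
    simp only [g]
    rw [EuclideanSpace.norm_sq_eq]
    simp
  have hfin : Module.finrank ℝ E - 1 = d := by simp [E]
  have h2 : ∫ x : E, g x = ∫ x, MvPolynomial.eval (fun i => x.1.1 i) p *
      (x.2.1 ^ n * Real.exp (-(1 / 2) * x.2.1 ^ 2))
        ∂((sphereMeasure d).prod (Measure.volumeIoiPow d)) := by
    have h3 : ∫ x : E, g x = ∫ x : ({(0)}ᶜ : Set E), g x.1 ∂(Measure.comap Subtype.val volume) := by
      rw [integral_subtype_comap (measurableSet_singleton _).compl g, restrict_compl_singleton]
    have h4 := (volume : Measure E).measurePreserving_homeomorphUnitSphereProd.integral_comp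
        (Homeomorph.measurableEmbedding _) (fun x => MvPolynomial.eval (fun i => x.1.1 i) p *
      (x.2.1 ^ n * Real.exp (-(1 / 2) * x.2.1 ^ 2)))
    rw [hfin] at h4
    rw [h3, sphereMeasure, ← h4]
    refine integral_congr_ae (ae_of_all _ fun x => ?_)
    have hx : ‖x.1‖ ≠ 0 := norm_ne_zero_iff.2 x.2
    have h5 : MvPolynomial.eval (fun i => x.1 i) p = ‖x.1‖ ^ n *
        MvPolynomial.eval (fun i => (‖x.1‖⁻¹ • x.1) i) p := by
      rw [← hp.eval_mul_left]
      refine congrArg (fun v => MvPolynomial.eval v p) (funext fun i => ?_)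
      rw [PiLp.smul_apply, smul_eq_mul, mul_inv_cancel_left₀ hx]
    simp only [g, homeomorphUnitSphereProd_apply_snd_coe, homeomorphUnitSphereProd_apply_fst_coe]
    rw [h5]
    ring
  rw [h2, integral_prod_mul (fun x : UnitSphere d => MvPolynomial.eval (fun i => x.1 i) p)
    (fun r : Set.Ioi (0 : ℝ) => r.1 ^ n * Real.exp (-(1 / 2) * r.1 ^ 2))] at h1
  refine (mul_eq_zero.1 h1).resolve_right (ne_of_gt ?_)
  simp only [Measure.volumeIoiPow, ENNReal.ofReal]
  rw [integral_withDensity_eq_integral_smul (measurable_subtype_coe.pow_const _).real_toNNReal,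
    integral_subtype_comap measurableSet_Ioi fun a : ℝ ↦
      Real.toNNReal (a ^ d) • (a ^ n * Real.exp (-(1 / 2) * a ^ 2))]
  have h6 := integral_rpow_mul_exp_neg_mul_rpow (p := 2) (q := (d + n : ℕ)) (b := 1 / 2)
    (by norm_num) (by have : (0 : ℝ) ≤ (d + n : ℕ) := by positivity
                      linarith) (by norm_num)
  rw [setIntegral_congr_fun measurableSet_Ioi (g := fun x : ℝ => x ^ ((d + n : ℕ) : ℝ) *
    Real.exp (-(1 / 2) * x ^ (2 : ℝ))), h6]
  · have : 0 < Real.Gamma ((((d + n : ℕ) : ℝ) + 1) / 2) := Real.Gamma_pos_of_pos (by positivity)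
    positivity
  · intro x hx
    simp only [NNReal.smul_def, Real.coe_toNNReal _ (pow_nonneg (le_of_lt hx) _), smul_eq_mul,
      Real.rpow_natCast, Real.rpow_two, pow_add]
    ring

theorem sum_sq_sphere {d : ℕ} (x : UnitSphere d) : ∑ i, x.1 i ^ 2 = 1 := by
  have h := EuclideanSpace.norm_sq_eq x.1
  rw [norm_eq_of_mem_sphere x] at h
  simpa using h.symm

theorem sphereDot_eq_sum {d : ℕ} (x y : UnitSphere d) : sphereDot x y = ∑ i, x.1 i * y.1 i := by
  simp [sphereDot, PiLp.inner_apply, mul_comm]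

theorem integral_zonalPoly_mul_zonalPoly {d : ℕ} (hd : 1 ≤ d) {k l : ℕ} (hkl : k ≠ l)
    (e : UnitSphere d) :
    ∫ x, (zonalPoly d k).eval (sphereDot e x) * (zonalPoly d l).eval (sphereDot e x)
      ∂sphereMeasure d = 0 := by
  have he := sum_sq_sphere e
  have hcard : Fintype.card (Fin (d + 1)) = d + 1 := by simp
  have := integral_sphere_eq_zero_of_gaussInt
    ((MvPolynomial.isHomogeneous_zonalMv d (fun i => e.1 i) k).mul
      (MvPolynomial.isHomogeneous_zonalMv d (fun i => e.1 i) l))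
    (MvPolynomial.gaussInt_mul_eq_zero hkl (MvPolynomial.isHomogeneous_zonalMv d _ k)
      (MvPolynomial.isHomogeneous_zonalMv d _ l) (MvPolynomial.laplace_zonalMv hd hcard he k)
      (MvPolynomial.laplace_zonalMv hd hcard he l))
  rw [← this]
  refine integral_congr_ae (ae_of_all _ fun x => ?_)
  simp only [map_mul, MvPolynomial.eval_zonalMv d _ _ (sum_sq_sphere x), sphereDot_eq_sum]

theorem exists_zonalPoly_sphere_features {d : ℕ} (hd : 1 ≤ d) (n : ℕ) :
    ∃ (N : ℕ) (φ : Fin N → UnitSphere d → ℝ), ∀ x y : UnitSphere d,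
        (zonalPoly d n).eval (sphereDot x y) = ∑ j, φ j x * φ j y := by
  obtain ⟨S, φ, h⟩ := MvPolynomial.exists_zonalPoly_features (ι := Fin (d + 1)) hd (by simp) n
  refine ⟨S.card, fun j x => φ (S.equivFin.symm j) fun i => x.1 i, fun x y => ?_⟩
  rw [sphereDot_eq_sum, h _ _ (sum_sq_sphere x) (sum_sq_sphere y), ← Finset.sum_coe_sort]
  exact (Equiv.sum_comp S.equivFin.symm fun α : S =>
    φ α (fun i => x.1 i) * φ α (fun i => y.1 i)).symm

/-! ### Positive semidefinite kernels -/

/-- A real kernel is positive semidefinite if all its finite quadratic forms are nonnegative. -/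
def IsPSDKernel {X : Type*} (K : X → X → ℝ) : Prop :=
  ∀ (s : Finset X) (c : X → ℝ), 0 ≤ ∑ x ∈ s, ∑ y ∈ s, c x * c y * K x y

/-- The kernel has a finite-dimensional feature map. -/
def HasFeatures {X : Type*} (E : X → X → ℝ) : Prop :=
  ∃ (N : ℕ) (φ : Fin N → X → ℝ), ∀ x y, E x y = ∑ j, φ j x * φ j y

section Kernels

variable {X Y : Type*} {K L E : X → X → ℝ}

theorem IsPosDefKernel.isPSDKernel (h : IsPosDefKernel K) : IsPSDKernel K := by
  intro s c
  rcases s.eq_empty_or_nonempty with rfl | hs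
  · simp
  have := h.2 s.card hs.card_pos (fun i => (s.equivFin.symm i : X))
    (Subtype.val_injective.comp s.equivFin.symm.injective) (fun i => c (s.equivFin.symm i))
  rw [← Finset.sum_coe_sort s]
  simp only [← Finset.sum_coe_sort s (fun y => c _ * c y * K _ y)]
  rw [← Equiv.sum_comp s.equivFin.symm]
  simpa only [← Equiv.sum_comp s.equivFin.symm (fun y : s => c _ * c y * K _ y)] using this

/-- Coincident points are merged by adding their coefficients; this allows a kernel to be tested on
families with repetitions. -/
theorem sum_sum_mul_eq_sum_image {J : Type*} [DecidableEq X] (s : Finset J) (x : J → X)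
    (c : J → ℝ) (K : X → X → ℝ) :
    ∑ i ∈ s, ∑ j ∈ s, c i * c j * K (x i) (x j) =
      ∑ u ∈ s.image x, ∑ v ∈ s.image x,
        (∑ i ∈ s with x i = u, c i) * (∑ j ∈ s with x j = v, c j) * K u v := by
  have hm : ∀ i ∈ s, x i ∈ s.image x := fun i hi => Finset.mem_image_of_mem x hi
  rw [← Finset.sum_fiberwise_of_maps_to hm]
  refine Finset.sum_congr rfl fun u _ => ?_
  rw [Finset.sum_congr rfl fun i _ => (Finset.sum_fiberwise_of_maps_to hm _).symm,
    Finset.sum_comm]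
  refine Finset.sum_congr rfl fun v _ => ?_
  rw [Finset.sum_mul_sum, Finset.sum_mul]
  refine Finset.sum_congr rfl fun i hi => ?_
  rw [Finset.sum_mul]
  refine Finset.sum_congr rfl fun j hj => ?_
  rw [(Finset.mem_filter.1 hi).2, (Finset.mem_filter.1 hj).2]

theorem IsPSDKernel.sum_nonneg (h : IsPSDKernel K) {J : Type*} (s : Finset J) (x : J → X)
    (c : J → ℝ) : 0 ≤ ∑ i ∈ s, ∑ j ∈ s, c i * c j * K (x i) (x j) := by
  classical
  rw [sum_sum_mul_eq_sum_image]
  exact h _ fun u => ∑ i ∈ s with x i = u, c i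

theorem IsPSDKernel.add (hK : IsPSDKernel K) (hL : IsPSDKernel L) :
    IsPSDKernel fun x y => K x y + L x y := fun s c => by
  simp only [mul_add, Finset.sum_add_distrib]
  exact add_nonneg (hK s c) (hL s c)

theorem IsPSDKernel.const_mul (hK : IsPSDKernel K) {a : ℝ} (ha : 0 ≤ a) :
    IsPSDKernel fun x y => a * K x y := fun s c => by
  simp only [mul_left_comm _ a, ← Finset.mul_sum]
  exact mul_nonneg ha (hK s c)

theorem isPSDKernel_one : IsPSDKernel fun _ _ : X => (1 : ℝ) := fun s c => by
  simp only [mul_one]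
  rw [← Finset.sum_mul_sum]
  exact mul_self_nonneg _

/-- A Schur product theorem: each feature is absorbed into the coefficients of the form of K. -/
theorem HasFeatures.isPSDKernel_mul (hE : HasFeatures E) (hK : IsPSDKernel K) :
    IsPSDKernel fun x y => E x y * K x y := by
  obtain ⟨N, φ, h⟩ := hE
  intro s c
  have : ∑ x ∈ s, ∑ y ∈ s, c x * c y * (E x y * K x y) =
      ∑ j, ∑ x ∈ s, ∑ y ∈ s, (c x * φ j x) * (c y * φ j y) * K x y := by
    symm
    rw [Finset.sum_comm]
    refine Finset.sum_congr rfl fun x _ => ?_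
    rw [Finset.sum_comm]
    refine Finset.sum_congr rfl fun y _ => ?_
    rw [h, Finset.sum_mul, Finset.mul_sum]
    exact Finset.sum_congr rfl fun j _ => by ring
  rw [this]
  exact Finset.sum_nonneg fun j _ => hK s fun x => c x * φ j x

theorem HasFeatures.isPSDKernel (hE : HasFeatures E) : IsPSDKernel E := by
  simpa using hE.isPSDKernel_mul isPSDKernel_one

theorem HasFeatures.comp (hE : HasFeatures E) (g : Y → X) :
    HasFeatures fun x y => E (g x) (g y) := by
  obtain ⟨N, φ, h⟩ := hE
  exact ⟨N, fun j y => φ j (g y), fun x y => h _ _⟩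

theorem HasFeatures.abs_le (hE : HasFeatures E) (x y : X) : |E x y| ≤ (E x x + E y y) / 2 := by
  obtain ⟨N, φ, h⟩ := hE
  rw [h, h, h, ← Finset.sum_add_distrib, Finset.sum_div]
  refine (Finset.abs_sum_le_sum_abs _ _).trans (Finset.sum_le_sum fun j _ => ?_)
  rw [_root_.abs_le]
  constructor <;> nlinarith [sq_nonneg (φ j x + φ j y), sq_nonneg (φ j x - φ j y)]

end Kernels

/-! ### Integrals of positive semidefinite kernels -/

section Integration

variable {X : Type*} [PseudoMetricSpace X] [CompactSpace X] [MeasurableSpace X] [BorelSpace X]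

theorem integral_comp_simpleFunc {X Y : Type*} [MeasurableSpace X] (μ : Measure X)
    [IsFiniteMeasure μ] (s : SimpleFunc X Y) (h : Y → ℝ) :
    ∫ x, h (s x) ∂μ = ∑ v ∈ s.range, μ.real (s ⁻¹' {v}) * h v := by
  classical
  have h1 : ∀ x, h (s x) = ∑ v ∈ s.range, (s ⁻¹' {v}).indicator (fun _ => h v) x := by
    intro x
    rw [Finset.sum_eq_single_of_mem (s x) (SimpleFunc.mem_range_self s x)]
    · simp
    · intro v _ hv
      simp [hv.symm]
  simp only [h1]
  rw [integral_finsetSum]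
  · refine Finset.sum_congr rfl fun v _ => ?_
    rw [integral_indicator_const _ (s.measurableSet_preimage _), smul_eq_mul]
  · intro v _
    exact (integrable_const _).indicator (s.measurableSet_preimage _)

/-- Approximating the identity of X by simple functions turns the double integral into quadratic
forms of K whose coefficients are measures of level sets. -/
theorem IsPSDKernel.integral_nonneg {K : X → X → ℝ} (hK : IsPSDKernel K)
    (hc : Continuous fun q : X × X => K q.1 q.2) (μ : Measure X) [IsFiniteMeasure μ] :
    0 ≤ ∫ x, ∫ y, K x y ∂μ ∂μ := by
  rcases isEmpty_or_nonempty X with hX | ⟨⟨x₀⟩⟩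
  · rw [Measure.eq_zero_of_isEmpty μ]; simp
  obtain ⟨C, hC⟩ : ∃ C, ∀ x y, ‖K x y‖ ≤ C := by
    obtain ⟨C, hC⟩ := isCompact_univ.exists_bound_of_continuousOn hc.continuousOn
    exact ⟨C, fun x y => hC (x, y) trivial⟩
  let s : ℕ → SimpleFunc X X := SimpleFunc.approxOn id measurable_id Set.univ x₀ trivial
  have hs : ∀ x, Tendsto (fun n => s n x) atTop (𝓝 x) := fun x =>
    SimpleFunc.tendsto_approxOn measurable_id (Set.mem_univ x₀) (by simp)
  have hinner : ∀ x, Tendsto (fun n => ∫ y, K (s n x) (s n y) ∂μ) atTop (𝓝 (∫ y, K x y ∂μ)) := by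
    intro x
    refine tendsto_integral_of_dominated_convergence (fun _ => C)
      (fun n => ((s n).map (K (s n x))).aestronglyMeasurable) (integrable_const _)
      (fun n => ae_of_all _ fun y => hC _ _) (ae_of_all _ fun y => ?_)
    exact (hc.tendsto (x, y)).comp ((hs x).prodMk_nhds (hs y))
  have houter : Tendsto (fun n => ∫ x, ∫ y, K (s n x) (s n y) ∂μ ∂μ) atTop
      (𝓝 (∫ x, ∫ y, K x y ∂μ ∂μ)) := by
    refine tendsto_integral_of_dominated_convergence (fun _ => C * μ.real Set.univ)
      (fun n => ((s n).map fun u => ∫ y, K u (s n y) ∂μ).aestronglyMeasurable)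
      (integrable_const _) (fun n => ae_of_all _ fun x => ?_) (ae_of_all _ hinner)
    exact norm_integral_le_of_norm_le_const (ae_of_all _ fun y => hC _ _)
  refine ge_of_tendsto' houter fun n => ?_
  rw [integral_comp_simpleFunc μ (s n) fun u => ∫ y, K u (s n y) ∂μ]
  have := hK (s n).range fun v => μ.real (s n ⁻¹' {v})
  refine this.trans_eq (Finset.sum_congr rfl fun u _ => ?_)
  rw [integral_comp_simpleFunc μ (s n) (K u), Finset.mul_sum]
  exact Finset.sum_congr rfl fun v _ => by ring

end Integration

/-! ### Isometries and great circles of the sphere -/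

section Sphere

variable {d : ℕ}

theorem abs_sphereDot_le (x y : UnitSphere d) : |sphereDot x y| ≤ 1 := by
  have := abs_real_inner_le_norm x.1 y.1
  rwa [norm_eq_of_mem_sphere x, norm_eq_of_mem_sphere y, mul_one] at this

theorem sphereDot_self (x : UnitSphere d) : sphereDot x x = 1 := by
  rw [sphereDot, real_inner_self_eq_norm_sq, norm_eq_of_mem_sphere x, one_pow]

theorem continuous_sphereDot : Continuous fun q : UnitSphere d × UnitSphere d =>
    sphereDot q.1 q.2 := by
  unfold sphereDot; fun_prop

/-- The inner product of two points of the sphere as an element of `[-1,1]`. -/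
def dotIcc (x y : UnitSphere d) : Set.Icc (-1 : ℝ) 1 :=
  ⟨sphereDot x y, abs_le.1 (abs_sphereDot_le x y)⟩

theorem continuous_dotIcc : Continuous fun q : UnitSphere d × UnitSphere d => dotIcc q.1 q.2 :=
  continuous_sphereDot.subtype_mk _

theorem hasFeatures_zonalPoly (hd : 1 ≤ d) (n : ℕ) :
    HasFeatures fun x y : UnitSphere d => (zonalPoly d n).eval (sphereDot x y) :=
  exists_zonalPoly_sphere_features hd n

/-- The action of a linear isometry on the sphere. -/
def sphereMap (U : EuclideanSpace ℝ (Fin (d + 1)) ≃ₗᵢ[ℝ] EuclideanSpace ℝ (Fin (d + 1)))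
    (x : UnitSphere d) : UnitSphere d :=
  ⟨U x.1, by simp⟩

/-- The surface measure of a set is a multiple of the volume of the cone over it, and linear
isometries carry cones to cones and preserve volume. -/
theorem measurePreserving_sphereMap
    (U : EuclideanSpace ℝ (Fin (d + 1)) ≃ₗᵢ[ℝ] EuclideanSpace ℝ (Fin (d + 1))) :
    MeasurePreserving (sphereMap U) (sphereMeasure d) (sphereMeasure d) := by
  have hcont : Continuous (sphereMap U) :=
    (U.continuous.comp continuous_subtype_val).subtype_mk _
  refine ⟨hcont.measurable, Measure.ext fun s hs => ?_⟩
  rw [Measure.map_apply hcont.measurable hs, sphereMeasure,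
    Measure.toSphere_apply' _ (hcont.measurable hs), Measure.toSphere_apply' _ hs]
  congr 1
  refine Eq.trans ?_ (U.measurePreserving.measure_preimage_emb
    U.toHomeomorph.measurableEmbedding _)
  congr 1
  ext x
  simp only [Set.mem_smul, Set.mem_preimage, Set.mem_image]
  constructor
  · rintro ⟨r, hr, _, ⟨y, hy, rfl⟩, rfl⟩
    exact ⟨r, hr, _, ⟨sphereMap U y, hy, rfl⟩, by simp [sphereMap]⟩
  · rintro ⟨r, hr, _, ⟨y, hy, rfl⟩, h⟩
    refine ⟨r, hr, _, ⟨sphereMap U.symm y, ?_, rfl⟩, ?_⟩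
    · have : sphereMap U (sphereMap U.symm y) = y := Subtype.ext (by simp [sphereMap])
      rwa [this]
    · apply U.injective
      simpa [sphereMap] using h

/-- Two unit vectors are exchanged by the reflection in the hyperplane orthogonal to their
difference. -/
theorem exists_measurePreserving_sphereDot (x y : UnitSphere d) :
    ∃ T : UnitSphere d → UnitSphere d, MeasurePreserving T (sphereMeasure d) (sphereMeasure d) ∧
      ∀ z, sphereDot x z = sphereDot y (T z) := by
  let U := (ℝ ∙ (x.1 - y.1))ᗮ.reflection
  have hU : U x.1 = y.1 := Submodule.reflection_sub
    (by rw [norm_eq_of_mem_sphere x, norm_eq_of_mem_sphere y])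
  refine ⟨sphereMap U, measurePreserving_sphereMap U, fun z => ?_⟩
  simp only [sphereDot, sphereMap, ← hU]
  exact (U.inner_map_map _ _).symm

theorem inner_circle_vector (hd : 1 ≤ d) (θ ψ : ℝ) :
    inner ℝ (Real.cos θ • EuclideanSpace.single (0 : Fin (d + 1)) (1 : ℝ) +
        Real.sin θ • EuclideanSpace.single (Fin.last d) 1)
      (Real.cos ψ • EuclideanSpace.single (0 : Fin (d + 1)) (1 : ℝ) +
        Real.sin ψ • EuclideanSpace.single (Fin.last d) 1) = Real.cos (θ - ψ) := by
  have h : (0 : Fin (d + 1)) ≠ Fin.last d := by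
    intro h; have := congrArg Fin.val h; simp at this; omega
  simp [inner_add_left, inner_add_right, inner_smul_left, inner_smul_right,
      EuclideanSpace.inner_single_left, h, h.symm, Real.cos_sub]
  ring

/-- The point `(cos θ, 0, …, 0, sin θ)` of `S^d`. -/
def circlePoint (hd : 1 ≤ d) (θ : ℝ) : UnitSphere d :=
  ⟨Real.cos θ • EuclideanSpace.single 0 1 + Real.sin θ • EuclideanSpace.single (Fin.last d) 1, by
    rw [mem_sphere_zero_iff_norm, ← sq_eq_sq₀ (norm_nonneg _) zero_le_one,
      ← real_inner_self_eq_norm_sq, inner_circle_vector hd]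
    simp⟩

theorem sphereDot_circlePoint (hd : 1 ≤ d) (θ ψ : ℝ) :
    sphereDot (circlePoint hd θ) (circlePoint hd ψ) = Real.cos (θ - ψ) :=
  inner_circle_vector hd θ ψ

theorem exists_sphereDot_eq (hd : 1 ≤ d) {t : ℝ} (ht : t ∈ Set.Icc (-1 : ℝ) 1) :
    ∃ y : UnitSphere d, sphereDot (circlePoint hd 0) y = t :=
  ⟨circlePoint hd (Real.arccos t), by
    rw [sphereDot_circlePoint, zero_sub, Real.cos_neg, Real.cos_arccos ht.1 ht.2]⟩

theorem abs_eval_zonalPoly_le_one (hd : 1 ≤ d) (n : ℕ) {t : ℝ} (ht : t ∈ Set.Icc (-1 : ℝ) 1) :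
    |(zonalPoly d n).eval t| ≤ 1 := by
  obtain ⟨y, rfl⟩ := exists_sphereDot_eq hd ht
  have := (hasFeatures_zonalPoly hd n).abs_le (circlePoint hd 0) y
  simp only [sphereDot_self, eval_one_zonalPoly hd] at this
  linarith

end Sphere

/-! ### Orthogonal expansions with nonnegative coefficients -/

section Expansion

variable {Q : Type*} [TopologicalSpace Q] [CompactSpace Q] [TopologicalSpace.MetrizableSpace Q]
  [MeasurableSpace Q] [BorelSpace Q] (ν : Measure Q) [IsFiniteMeasure ν]

theorem integrable_continuousMap (h : C(Q, ℝ)) : Integrable h ν :=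
  h.continuous.integrable_of_hasCompactSupport (HasCompactSupport.of_compactSpace _)

/-- The functional `h ↦ ∫ h k dν` on `C(Q)`. -/
def integralMulCLM (k : C(Q, ℝ)) : C(Q, ℝ) →L[ℝ] ℝ :=
  LinearMap.mkContinuous
    { toFun := fun h => ∫ q, (h * k) q ∂ν
      map_add' := fun g h => by
        rw [← integral_add (integrable_continuousMap ν (g * k)) (integrable_continuousMap ν (h * k))]
        exact integral_congr_ae (ae_of_all _ fun q => by simp [add_mul])
      map_smul' := fun a h => by
        rw [RingHom.id_apply, smul_eq_mul, ← integral_const_mul]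
        exact integral_congr_ae (ae_of_all _ fun q => by simp) }
    (‖k‖ * ν.real Set.univ) fun h => by
      refine (norm_integral_le_of_norm_le_const (C := ‖h‖ * ‖k‖) (ae_of_all _ fun q => ?_)).trans_eq
        (by ring)
      exact ((h * k).norm_coe_le_norm q).trans (norm_mul_le _ _)

theorem integralMulCLM_apply (k h : C(Q, ℝ)) : integralMulCLM ν k h = ∫ q, h q * k q ∂ν := rfl

theorem integralMulCLM_comm (k h : C(Q, ℝ)) : integralMulCLM ν k h = integralMulCLM ν h k := by
  simp only [integralMulCLM_apply, mul_comm]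

variable [ν.IsOpenPosMeasure]

theorem integral_pos_of_continuousMap {h : C(Q, ℝ)} (h0 : ∀ q, 0 ≤ h q) {q : Q} (hq : h q ≠ 0) :
    0 < ∫ q, h q ∂ν :=
  h.continuous.integral_pos_of_hasCompactSupport_nonneg_nonzero
    (HasCompactSupport.of_compactSpace _) h0 hq

/-- Orthogonal expansion of a continuous function with nonnegative coefficients: under the
stated positivity assumptions the series converges absolutely and uniformly. -/
theorem exists_orthogonal_expansion {I : Type*} (e : I → C(Q, ℝ)) (q₁ : Q)
    (he1 : ∀ i, e i q₁ = 1) (hle : ∀ i q, |e i q| ≤ 1)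
    (horth : ∀ i j, i ≠ j → ∫ q, e i q * e j q ∂ν = 0)
    (hspan : (Submodule.span ℝ (Set.range e)).topologicalClosure = ⊤)
    (c : C(Q, ℝ)) (hc0 : ∀ q, 0 ≤ c q) (hc : ∀ q, q ≠ q₁ → c q < c q₁) (hcpos : 0 < c q₁)
    (hcspan : ∀ n : ℕ, c ^ n ∈ Submodule.span ℝ (Set.range e))
    (hce : ∀ (n : ℕ) (i : I), 0 ≤ ∫ q, c q ^ n * e i q ∂ν)
    (f : C(Q, ℝ)) (hf : ∀ i, 0 ≤ ∫ q, f q * e i q ∂ν) :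
    ∃ b : I → ℝ, (∀ i, 0 ≤ b i) ∧ Summable b ∧ ∀ q, HasSum (fun i => b i * e i q) (f q) := by
  classical
  set N : I → ℝ := fun i => ∫ q, e i q * e i q ∂ν
  have hN : ∀ i, 0 < N i := fun i =>
    integral_pos_of_continuousMap ν (h := e i * e i) (fun q => mul_self_nonneg _) (q := q₁)
      (by simp [he1])
  set b : I → ℝ := fun i => (∫ q, f q * e i q ∂ν) / N i
  have hb0 : ∀ i, 0 ≤ b i := fun i => div_nonneg (hf i) (hN i).le
  have hbN : ∀ i, b i * N i = ∫ q, f q * e i q ∂ν := fun i => div_mul_cancel₀ _ (hN i).ne'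
  -- Since c^n is a finite combination of the e i, its integral against f is a finite sum of
  -- nonnegative terms, hence dominates every partial sum.
  have hfin : ∀ (n : ℕ) (F : Finset I),
      ∑ i ∈ F, b i * ∫ q, c q ^ n * e i q ∂ν ≤ ∫ q, c q ^ n * f q ∂ν := by
    intro n F
    obtain ⟨a, ha⟩ := (Finsupp.mem_span_range_iff_exists_finsupp).1 (hcspan n)
    have hcint : ∀ k : C(Q, ℝ), ∫ q, c q ^ n * k q ∂ν = ∑ j ∈ a.support, a j * ∫ q, k q * e j q ∂ν := by
      intro k
      have h1 : ∫ q, c q ^ n * k q ∂ν = integralMulCLM ν k (c ^ n) := rfl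
      rw [h1, ← ha, Finsupp.sum, map_sum]
      refine Finset.sum_congr rfl fun j _ => ?_
      rw [map_smul, integralMulCLM_comm]; rfl
    have hcoef : ∀ i, ∫ q, c q ^ n * e i q ∂ν = a i * N i := by
      intro i
      rw [hcint, Finset.sum_eq_single i]
      · intro j _ hj
        rw [horth i j hj.symm, mul_zero]
      · intro hi
        rw [Finsupp.notMem_support_iff.1 hi, zero_mul]
    have hnn : ∀ i, 0 ≤ b i * (a i * N i) := fun i => mul_nonneg (hb0 i) (hcoef i ▸ hce n i)
    calc ∑ i ∈ F, b i * ∫ q, c q ^ n * e i q ∂ν = ∑ i ∈ F, b i * (a i * N i) := by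
          simp only [hcoef]
      _ ≤ ∑ i ∈ F ∪ a.support, b i * (a i * N i) :=
          Finset.sum_le_sum_of_subset_of_nonneg Finset.subset_union_left fun i _ _ => hnn i
      _ = ∑ i ∈ a.support, b i * (a i * N i) := by
          symm
          refine Finset.sum_subset Finset.subset_union_right fun i _ hi => ?_
          rw [Finsupp.notMem_support_iff.1 hi]; ring
      _ = ∫ q, c q ^ n * f q ∂ν := by
          rw [hcint]
          refine Finset.sum_congr rfl fun i _ => ?_
          rw [← hbN]; ring
  -- The normalized weights c^n concentrate at the unique maximum q₁; the limit in `hfin` then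
  -- bounds the partial sums of b by f q₁.
  have hpeak : ∀ g : C(Q, ℝ), Tendsto
      (fun n : ℕ => (∫ q, c q ^ n ∂ν)⁻¹ * ∫ q, c q ^ n * g q ∂ν) atTop (𝓝 (g q₁)) := by
    intro g
    have := tendsto_setIntegral_pow_smul_of_unique_maximum_of_isCompact_of_continuousOn
      (μ := ν) (isCompact_univ : IsCompact (Set.univ : Set Q)) c.continuous.continuousOn
      (fun y _ hy => hc y hy) (fun y _ => hc0 y) hcpos (by simp) g.continuous.continuousOn
    simpa using this
  have hbound : ∀ F : Finset I, ∑ i ∈ F, b i ≤ f q₁ := by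
    intro F
    have h1 : Tendsto (fun n : ℕ => ∑ i ∈ F, b i * ((∫ q, c q ^ n ∂ν)⁻¹ *
        ∫ q, c q ^ n * e i q ∂ν)) atTop (𝓝 (∑ i ∈ F, b i * e i q₁)) :=
      tendsto_finsetSum _ fun i _ => (hpeak (e i)).const_mul _
    simp only [he1, mul_one] at h1
    refine le_of_tendsto_of_tendsto' h1 (hpeak f) fun n => ?_
    have h2 : 0 ≤ (∫ q, c q ^ n ∂ν)⁻¹ :=
      inv_nonneg.2 (integral_nonneg fun q => pow_nonneg (hc0 q) n)
    have h3 := mul_le_mul_of_nonneg_left (hfin n F) h2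
    rw [Finset.mul_sum] at h3
    refine (Finset.sum_congr rfl fun i _ => ?_).trans_le h3
    ring
  have hbsum : Summable b := summable_of_sum_le hb0 hbound
  have hsum : Summable fun i => b i • e i := by
    refine Summable.of_norm_bounded hbsum fun i => ?_
    rw [norm_smul, Real.norm_of_nonneg (hb0 i)]
    refine mul_le_of_le_one_right (hb0 i) ?_
    exact (ContinuousMap.norm_le _ zero_le_one).2 fun q => hle i q
  obtain ⟨g, hg⟩ := hsum
  -- The uniform sum g has the same coefficients as f. By density of the span, f - g is orthogonal
  -- to every continuous function, itself included.
  have hge : ∀ j, integralMulCLM ν (e j) g = integralMulCLM ν (e j) f := by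
    intro j
    have h1 := hg.mapL (integralMulCLM ν (e j))
    have h2 : HasSum (fun i => integralMulCLM ν (e j) (b i • e i)) (b j * N j) := by
      have h3 : b j * N j = integralMulCLM ν (e j) (b j • e j) := by
        rw [map_smul]; rfl
      rw [h3]
      refine hasSum_single j fun i hij => ?_
      rw [map_smul, integralMulCLM_apply, horth i j hij, smul_zero]
    rw [h1.unique h2, hbN]; rfl
  have hzero : integralMulCLM ν (f - g) = 0 := by
    have h1 : Submodule.span ℝ (Set.range e) ≤ (integralMulCLM ν (f - g)).ker := by
      rw [Submodule.span_le]
      rintro _ ⟨j, rfl⟩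
      change integralMulCLM ν (f - g) (e j) = 0
      rw [integralMulCLM_comm, map_sub, hge, sub_self]
    have h2 := Submodule.topologicalClosure_minimal _ h1 (integralMulCLM ν (f - g)).isClosed_ker
    rw [hspan] at h2
    ext h
    exact h2 (Submodule.mem_top (x := h))
  have hfg : f = g := by
    by_contra hne
    obtain ⟨q, hq⟩ : ∃ q, (f - g) q ≠ 0 := by
      by_contra hall
      push Not at hall
      exact hne (sub_eq_zero.1 (ContinuousMap.ext hall))
    have h1 := integral_pos_of_continuousMap ν (h := (f - g) * (f - g))
      (fun q => mul_self_nonneg _) (q := q) (mul_self_ne_zero.2 hq)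
    have h2 : integralMulCLM ν (f - g) (f - g) = 0 := by rw [hzero]; rfl
    rw [integralMulCLM_apply] at h2
    exact h1.ne' h2
  refine ⟨b, hb0, hbsum, fun q => ?_⟩
  rw [hfg]
  exact hg.mapL (ContinuousMap.evalCLM ℝ q)

end Expansion

/-! ### Schoenberg's theorem on a product of two spheres -/

section ProductExpansion

/-- The square `[-1,1]²`. -/
abbrev DotSquare : Type := Set.Icc (-1 : ℝ) 1 × Set.Icc (-1 : ℝ) 1

/-- The function `(t, s) ↦ p(t) q(s)` on `[-1,1]²`. -/
def prodPoly (p q : ℝ[X]) : C(DotSquare, ℝ) where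
  toFun v := p.eval v.1.1 * q.eval v.2.1
  continuous_toFun := (p.continuous.comp (continuous_subtype_val.comp continuous_fst)).mul
    (q.continuous.comp (continuous_subtype_val.comp continuous_snd))

theorem prodPoly_apply (p q : ℝ[X]) (v : DotSquare) :
    prodPoly p q v = p.eval v.1.1 * q.eval v.2.1 := rfl

theorem prodPoly_mul (p q p' q' : ℝ[X]) :
    prodPoly p q * prodPoly p' q' = prodPoly (p * p') (q * q') := by
  ext v
  simp only [ContinuousMap.mul_apply, prodPoly_apply, Polynomial.eval_mul]
  ring

theorem prodPoly_pow (p q : ℝ[X]) (n : ℕ) : prodPoly p q ^ n = prodPoly (p ^ n) (q ^ n) := by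
  ext v
  simp [prodPoly_apply, mul_pow]

variable {d d' : ℕ}

theorem prodPoly_mem_span_zonal (hd : 1 ≤ d) (hd' : 1 ≤ d') (p q : ℝ[X]) :
    prodPoly p q ∈ Submodule.span ℝ
      (Set.range fun i : ℕ × ℕ => prodPoly (zonalPoly d i.1) (zonalPoly d' i.2)) := by
  have hp : p ∈ Submodule.span ℝ (Set.range (zonalPoly d)) := by
    rw [span_range_zonalPoly hd]; trivial
  have hq : q ∈ Submodule.span ℝ (Set.range (zonalPoly d')) := by
    rw [span_range_zonalPoly hd']; trivial
  induction hp using Submodule.span_induction with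
  | mem p hp =>
    obtain ⟨k, rfl⟩ := hp
    induction hq using Submodule.span_induction with
    | mem q hq =>
      obtain ⟨l, rfl⟩ := hq
      exact Submodule.subset_span ⟨(k, l), rfl⟩
    | zero =>
      convert! Submodule.zero_mem _ using 1
      ext v; simp [prodPoly_apply]
    | add q q' _ _ h h' =>
      convert! Submodule.add_mem _ h h' using 1
      ext v; simp [prodPoly_apply, mul_add]
    | smul a q _ h =>
      convert! Submodule.smul_mem _ a h using 1
      ext v; simp [prodPoly_apply, mul_left_comm]
  | zero =>
    convert! Submodule.zero_mem _ using 1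
    ext v; simp [prodPoly_apply]
  | add p p' _ _ h h' =>
    convert! Submodule.add_mem _ h h' using 1
    ext v; simp [prodPoly_apply, add_mul]
  | smul a p _ h =>
    convert! Submodule.smul_mem _ a h using 1
    ext v; simp [prodPoly_apply, mul_assoc]

/-- Stone–Weierstrass for the algebra generated by the two coordinates, whose monomials are all of
the form p(t) q(s). -/
theorem span_prodPoly_zonal_dense (hd : 1 ≤ d) (hd' : 1 ≤ d') :
    (Submodule.span ℝ (Set.range fun i : ℕ × ℕ =>
      prodPoly (zonalPoly d i.1) (zonalPoly d' i.2))).topologicalClosure = ⊤ := by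
  set A : Subalgebra ℝ C(DotSquare, ℝ) :=
    Algebra.adjoin ℝ {prodPoly Polynomial.X 1, prodPoly 1 Polynomial.X}
  have hsep : A.SeparatesPoints := by
    intro v w hvw
    by_cases h1 : v.1 = w.1
    · refine ⟨_, ⟨_, Algebra.subset_adjoin (Set.mem_insert_of_mem _ rfl), rfl⟩, ?_⟩
      have h2 : v.2 ≠ w.2 := fun h2 => hvw (Prod.ext h1 h2)
      simpa [prodPoly_apply] using fun h => h2 (Subtype.ext h)
    · refine ⟨_, ⟨_, Algebra.subset_adjoin (Set.mem_insert _ _), rfl⟩, ?_⟩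
      simpa [prodPoly_apply] using fun h => h1 (Subtype.ext h)
  have hA := ContinuousMap.subalgebra_topologicalClosure_eq_top_of_separatesPoints A hsep
  have hle : Subalgebra.toSubmodule A ≤ Submodule.span ℝ (Set.range fun i : ℕ × ℕ =>
      prodPoly (zonalPoly d i.1) (zonalPoly d' i.2)) := by
    rw [Algebra.adjoin_eq_span, Submodule.span_le]
    intro g hg
    have : ∃ p q, g = prodPoly p q := by
      induction hg using Submonoid.closure_induction with
      | mem g hg =>
        rcases hg with rfl | rfl
        · exact ⟨_, _, rfl⟩
        · exact ⟨_, _, rfl⟩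
      | one => exact ⟨1, 1, by ext v; simp [prodPoly_apply]⟩
      | mul g h _ _ hg hh =>
        obtain ⟨p, q, rfl⟩ := hg
        obtain ⟨p', q', rfl⟩ := hh
        exact ⟨_, _, prodPoly_mul _ _ _ _⟩
    obtain ⟨p, q, rfl⟩ := this
    exact prodPoly_mem_span_zonal hd hd' p q
  rw [eq_top_iff]
  intro g _
  have hg : g ∈ A.topologicalClosure := by rw [hA]; trivial
  exact closure_mono (s := (A : Set C(DotSquare, ℝ))) hle hg

/-- The pair of inner products of two points of `S^d × S^d'`. -/
def dotPair (ξ η : UnitSphere d × UnitSphere d') : DotSquare := (dotIcc ξ.1 η.1, dotIcc ξ.2 η.2)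

theorem continuous_dotPair : Continuous
    fun q : (UnitSphere d × UnitSphere d') × (UnitSphere d × UnitSphere d') =>
      dotPair q.1 q.2 :=
  (continuous_dotIcc.comp (by fun_prop : Continuous
    fun q : (UnitSphere d × UnitSphere d') × (UnitSphere d × UnitSphere d') =>
      (q.1.1, q.2.1))).prodMk
  (continuous_dotIcc.comp (by fun_prop : Continuous
    fun q : (UnitSphere d × UnitSphere d') × (UnitSphere d × UnitSphere d') =>
      (q.1.2, q.2.2)))

theorem continuous_dotPair_right (ξ : UnitSphere d × UnitSphere d') : Continuous (dotPair ξ) :=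
  continuous_dotPair.comp (Continuous.prodMk_right ξ)

theorem exists_measurePreserving_dotPair (ξ η : UnitSphere d × UnitSphere d') :
    ∃ T : UnitSphere d × UnitSphere d' → UnitSphere d × UnitSphere d',
      MeasurePreserving T ((sphereMeasure d).prod (sphereMeasure d'))
        ((sphereMeasure d).prod (sphereMeasure d')) ∧
      ∀ ζ, dotPair ξ ζ = dotPair η (T ζ) := by
  obtain ⟨T, hT, h⟩ := exists_measurePreserving_sphereDot ξ.1 η.1
  obtain ⟨T', hT', h'⟩ := exists_measurePreserving_sphereDot ξ.2 η.2
  exact ⟨Prod.map T T', hT.prod hT', fun ζ => Prod.ext (Subtype.ext (h _)) (Subtype.ext (h' _))⟩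

theorem integral_dotPair_eq (h : C(DotSquare, ℝ)) (ξ η : UnitSphere d × UnitSphere d') :
    ∫ ζ, h (dotPair ξ ζ) ∂((sphereMeasure d).prod (sphereMeasure d')) =
      ∫ ζ, h (dotPair η ζ) ∂((sphereMeasure d).prod (sphereMeasure d')) := by
  obtain ⟨T, hT, hT'⟩ := exists_measurePreserving_dotPair ξ η
  simp only [hT']
  conv_rhs => rw [← hT.map_eq]
  rw [integral_map hT.measurable.aemeasurable]
  exact (h.continuous.comp (continuous_dotPair_right η)).aestronglyMeasurable

/-- By invariance the inner integral does not depend on the base point, so the nonnegative double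
integral is the total mass times the single one. -/
theorem integral_dotPair_nonneg (h : C(DotSquare, ℝ))
    (hpsd : IsPSDKernel fun ξ η : UnitSphere d × UnitSphere d' => h (dotPair ξ η))
    (ξ : UnitSphere d × UnitSphere d') :
    0 ≤ ∫ ζ, h (dotPair ξ ζ) ∂((sphereMeasure d).prod (sphereMeasure d')) := by
  have h1 := hpsd.integral_nonneg (h.continuous.comp continuous_dotPair)
    ((sphereMeasure d).prod (sphereMeasure d'))
  simp only [integral_dotPair_eq h _ ξ] at h1
  rw [integral_const, smul_eq_mul] at h1
  have h2 : 0 < ((sphereMeasure d).prod (sphereMeasure d')).real Set.univ := by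
    rw [measureReal_def, ENNReal.toReal_pos_iff]
    exact ⟨isOpen_univ.measure_pos _ ⟨ξ, trivial⟩, measure_lt_top _ _⟩
  exact nonneg_of_mul_nonneg_right h1 h2

/-- The distribution of the pair of inner products with a base point. -/
def dotMeasure (hd : 1 ≤ d) (hd' : 1 ≤ d') : Measure DotSquare :=
  ((sphereMeasure d).prod (sphereMeasure d')).map (dotPair (circlePoint hd 0, circlePoint hd' 0))

theorem integral_dotMeasure (hd : 1 ≤ d) (hd' : 1 ≤ d') (h : C(DotSquare, ℝ)) :
    ∫ v, h v ∂dotMeasure hd hd' = ∫ ζ, h (dotPair (circlePoint hd 0, circlePoint hd' 0) ζ)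
      ∂((sphereMeasure d).prod (sphereMeasure d')) := by
  rw [dotMeasure, integral_map (continuous_dotPair_right _).aemeasurable
    h.continuous.aestronglyMeasurable]

instance (hd : 1 ≤ d) (hd' : 1 ≤ d') : IsFiniteMeasure (dotMeasure hd hd') := by
  unfold dotMeasure; infer_instance

instance (hd : 1 ≤ d) (hd' : 1 ≤ d') : (dotMeasure hd hd').IsOpenPosMeasure := by
  refine ⟨fun U hU ⟨v, hv⟩ => ?_⟩
  rw [dotMeasure, Measure.map_apply (continuous_dotPair_right _).measurable hU.measurableSet]
  obtain ⟨y, hy⟩ := exists_sphereDot_eq hd v.1.2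
  obtain ⟨y', hy'⟩ := exists_sphereDot_eq hd' v.2.2
  refine ((hU.preimage (continuous_dotPair_right _)).measure_pos _ ⟨(y, y'), ?_⟩).ne'
  have : dotPair (circlePoint hd 0, circlePoint hd' 0) (y, y') = v :=
    Prod.ext (Subtype.ext hy) (Subtype.ext hy')
  rwa [Set.mem_preimage, this]

theorem integral_dotMeasure_zonal (hd : 1 ≤ d) (hd' : 1 ≤ d') {i j : ℕ × ℕ} (hij : i ≠ j) :
    ∫ v, prodPoly (zonalPoly d i.1) (zonalPoly d' i.2) v *
      prodPoly (zonalPoly d j.1) (zonalPoly d' j.2) v ∂dotMeasure hd hd' = 0 := by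
  have h1 := integral_dotMeasure hd hd' (prodPoly (zonalPoly d i.1) (zonalPoly d' i.2) *
      prodPoly (zonalPoly d j.1) (zonalPoly d' j.2))
  simp only [ContinuousMap.mul_apply] at h1
  have h2 : ∀ ζ, prodPoly (zonalPoly d i.1) (zonalPoly d' i.2)
      (dotPair (circlePoint hd 0, circlePoint hd' 0) ζ) *
      prodPoly (zonalPoly d j.1) (zonalPoly d' j.2)
      (dotPair (circlePoint hd 0, circlePoint hd' 0) ζ) =
      ((zonalPoly d i.1).eval (sphereDot (circlePoint hd 0) ζ.1) *
        (zonalPoly d j.1).eval (sphereDot (circlePoint hd 0) ζ.1)) *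
      ((zonalPoly d' i.2).eval (sphereDot (circlePoint hd' 0) ζ.2) *
        (zonalPoly d' j.2).eval (sphereDot (circlePoint hd' 0) ζ.2)) := by
    intro ζ
    simp only [prodPoly_apply, dotPair, dotIcc]
    ring
  rw [h1]
  simp only [h2]
  rw [integral_prod_mul (fun x : UnitSphere d =>
    (zonalPoly d i.1).eval (sphereDot (circlePoint hd 0) x) *
        (zonalPoly d j.1).eval (sphereDot (circlePoint hd 0) x))
    (fun z : UnitSphere d' => (zonalPoly d' i.2).eval (sphereDot (circlePoint hd' 0) z) *
        (zonalPoly d' j.2).eval (sphereDot (circlePoint hd' 0) z))]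
  by_cases h : i.1 = j.1
  · rw [integral_zonalPoly_mul_zonalPoly hd' (fun h' => hij (Prod.ext h h')), mul_zero]
  · rw [integral_zonalPoly_mul_zonalPoly hd h, zero_mul]

theorem isPSDKernel_zonal_mul (hd : 1 ≤ d) (hd' : 1 ≤ d') (k l : ℕ)
    {K : UnitSphere d × UnitSphere d' → UnitSphere d × UnitSphere d' → ℝ} (hK : IsPSDKernel K) :
    IsPSDKernel fun ξ η => (zonalPoly d k).eval (sphereDot ξ.1 η.1) *
      ((zonalPoly d' l).eval (sphereDot ξ.2 η.2) * K ξ η) :=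
  ((hasFeatures_zonalPoly hd k).comp Prod.fst).isPSDKernel_mul
    (((hasFeatures_zonalPoly hd' l).comp Prod.snd).isPSDKernel_mul hK)

theorem isPSDKernel_peak_mul (hd : 1 ≤ d) (hd' : 1 ≤ d')
    {K : UnitSphere d × UnitSphere d' → UnitSphere d × UnitSphere d' → ℝ} (hK : IsPSDKernel K) :
    IsPSDKernel fun ξ η => (1 + sphereDot ξ.1 η.1) * (1 + sphereDot ξ.2 η.2) * K ξ η := by
  have h := (((hK.add (isPSDKernel_zonal_mul hd hd' 0 1 hK)).add
    (isPSDKernel_zonal_mul hd hd' 1 0 hK))).add (isPSDKernel_zonal_mul hd hd' 1 1 hK)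
  convert! h using 3
  simp [zonalPoly]
  ring

/-- Schoenberg's theorem on a product of two spheres: a continuous isotropic positive
semidefinite kernel is an absolutely convergent series of products of zonal polynomials with
nonnegative coefficients. -/
theorem exists_zonal_expansion (hd : 1 ≤ d) (hd' : 1 ≤ d') (f : C(DotSquare, ℝ))
    (hf : IsPSDKernel fun ξ η : UnitSphere d × UnitSphere d' => f (dotPair ξ η)) :
    ∃ b : ℕ × ℕ → ℝ, (∀ i, 0 ≤ b i) ∧ Summable b ∧ ∀ v : DotSquare,
      HasSum (fun i => b i * ((zonalPoly d i.1).eval v.1.1 * (zonalPoly d' i.2).eval v.2.1))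
        (f v) := by
  have hone : (1 : ℝ) ∈ Set.Icc (-1 : ℝ) 1 := by norm_num
  set e : ℕ × ℕ → C(DotSquare, ℝ) := fun i => prodPoly (zonalPoly d i.1) (zonalPoly d' i.2)
  -- On the square, (1+t)(1+s) is nonnegative with its maximum only at (1,1). It is the sum of the
  -- four products of Z_0 and Z_1, so its powers give positive semidefinite kernels.
  set c : C(DotSquare, ℝ) := prodPoly (1 + Polynomial.X) (1 + Polynomial.X)
  have hcv : ∀ v, c v = (1 + v.1.1) * (1 + v.2.1) := fun v => by simp [c, prodPoly_apply]
  refine exists_orthogonal_expansion (dotMeasure hd hd') e (⟨1, hone⟩, ⟨1, hone⟩) ?_ ?_ ?_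
    (span_prodPoly_zonal_dense hd hd') c ?_ ?_ ?_ ?_ ?_ f ?_
  · intro i
    simp [e, prodPoly_apply, eval_one_zonalPoly hd, eval_one_zonalPoly hd']
  · intro i v
    simp only [e, prodPoly_apply, abs_mul]
    exact mul_le_one₀ (abs_eval_zonalPoly_le_one hd _ v.1.2) (abs_nonneg _)
      (abs_eval_zonalPoly_le_one hd' _ v.2.2)
  · intro i j hij
    exact integral_dotMeasure_zonal hd hd' hij
  · intro v
    rw [hcv]
    exact mul_nonneg (by linarith [v.1.2.1]) (by linarith [v.2.2.1])
  · intro v hv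
    rw [hcv, hcv]
    have h1 := v.1.2.1
    have h2 := v.1.2.2
    have h3 := v.2.2.1
    have h4 := v.2.2.2
    have h5 : v.1.1 < 1 ∨ v.2.1 < 1 := by
      by_contra hcon
      push Not at hcon
      exact hv (Prod.ext (Subtype.ext (le_antisymm h2 hcon.1))
        (Subtype.ext (le_antisymm h4 hcon.2)))
    rcases h5 with h5 | h5 <;> nlinarith
  · rw [hcv]; norm_num
  · intro n
    simp only [c, prodPoly_pow]
    exact prodPoly_mem_span_zonal hd hd' _ _
  · intro n i
    have h1 := integral_dotMeasure hd hd' (c ^ n * e i)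
    simp only [ContinuousMap.mul_apply, ContinuousMap.pow_apply] at h1
    rw [h1]
    refine integral_dotPair_nonneg (c ^ n * e i) ?_ _
    have hpow : ∀ n : ℕ, IsPSDKernel fun ξ η : UnitSphere d × UnitSphere d' =>
        (c ^ n) (dotPair ξ η) := by
      intro n
      induction n with
      | zero => simpa using isPSDKernel_one
      | succ n ih =>
        convert! isPSDKernel_peak_mul hd hd' ih using 3
        rw [pow_succ', ContinuousMap.mul_apply, hcv]
        rfl
    convert! isPSDKernel_zonal_mul hd hd' i.1 i.2 (hpow n) using 3
    simp only [ContinuousMap.mul_apply, e, prodPoly_apply, dotPair, dotIcc]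
    ring
  · intro i
    have h1 := integral_dotMeasure hd hd' (f * e i)
    simp only [ContinuousMap.mul_apply] at h1
    rw [h1]
    refine integral_dotPair_nonneg (f * e i) ?_ _
    convert! isPSDKernel_zonal_mul hd hd' i.1 i.2 hf using 3
    simp only [ContinuousMap.mul_apply, e, prodPoly_apply, dotPair, dotIcc]
    ring

end ProductExpansion

theorem exists_isDoubleGegenbauerSeries {m : ℕ} (hm : 2 ≤ m) {f : ℝ → ℝ → ℝ}
    (hcont : ContinuousOn (fun q : ℝ × ℝ => f q.1 q.2)
      (Set.Icc (-1 : ℝ) 1 ×ˢ Set.Icc (-1 : ℝ) 1))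
    (hpd : IsPosDefKernel (circleSphereKernel m f)) :
    ∃ a : ℕ → ℕ → ℝ, IsDoubleGegenbauerSeries m f a := by
  let F : C(DotSquare, ℝ) :=
    ⟨fun v => f v.1.1 v.2.1, hcont.comp_continuous
      ((continuous_subtype_val.comp continuous_fst).prodMk
        (continuous_subtype_val.comp continuous_snd)) fun v => ⟨v.1.2, v.2.2⟩⟩
  obtain ⟨b, hb0, hbs, hb⟩ := exists_zonal_expansion (d := 1) (d' := m) le_rfl (by omega) F
    hpd.isPSDKernel
  have hv := gegenbauerValue_sphere_pos hm
  have hterm : ∀ (i : ℕ × ℕ) (t s : ℝ),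
      b i / (circleValue i.1 * gegenbauerValue (((m : ℝ) - 1) / 2) i.2) *
        (circlePoly i.1).eval t * (spherePoly m i.2).eval s =
      b i * ((zonalPoly 1 i.1).eval t * (zonalPoly m i.2).eval s) := by
    intro i t s
    have h1 := (circleValue_pos i.1).ne'
    have h2 := (hv i.2).ne'
    rw [circlePoly_eq, spherePoly_eq hm, Polynomial.eval_mul, Polynomial.eval_mul,
      Polynomial.eval_C, Polynomial.eval_C]
    field_simp
  refine ⟨fun k l => b (k, l) / (circleValue k * gegenbauerValue (((m : ℝ) - 1) / 2) l),
    fun k l => div_nonneg (hb0 _) (mul_nonneg (circleValue_pos k).le (hv l).le), ?_, ?_⟩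
  · refine hbs.congr fun i => ?_
    rw [hterm i 1 1, eval_one_zonalPoly le_rfl, eval_one_zonalPoly (by omega)]
    ring
  · intro t ht s hs
    have h : HasSum (fun i : ℕ × ℕ => b i * ((zonalPoly 1 i.1).eval t * (zonalPoly m i.2).eval s))
      (f t s) := hb (⟨t, ht⟩, ⟨s, hs⟩)
    simp only [← hterm] at h
    exact h

/-! ### Alternating sums over regular polygons -/

section Polygon

/-- The span of the functions `θ ↦ cos(kθ)` with `k ≤ l` and `k ≡ l` modulo `2`. -/
def cosSpan (l : ℕ) : Submodule ℝ (ℝ → ℝ) :=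
  Submodule.span ℝ {g | ∃ k : ℕ, k ≤ l ∧ k % 2 = l % 2 ∧ g = fun θ => Real.cos (k * θ)}

theorem cosSpan_le_add_two (l : ℕ) : cosSpan l ≤ cosSpan (l + 2) := by
  refine Submodule.span_mono ?_
  rintro _ ⟨k, hk, hk2, rfl⟩
  exact ⟨k, by omega, by omega, rfl⟩

theorem cos_mul_mem_cosSpan {l : ℕ} {g : ℝ → ℝ} (hg : g ∈ cosSpan l) :
    (fun θ => Real.cos θ * g θ) ∈ cosSpan (l + 1) := by
  induction hg using Submodule.span_induction with
  | mem g hg =>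
    obtain ⟨k, hk, hk2, rfl⟩ := hg
    rcases k with _ | k
    · refine Submodule.subset_span ⟨1, by omega, by omega, ?_⟩
      funext θ; simp
    · have h1 : (fun θ : ℝ => Real.cos ((k + 2 : ℕ) * θ)) ∈ cosSpan (l + 1) :=
        Submodule.subset_span ⟨k + 2, by omega, by omega, rfl⟩
      have h2 : (fun θ : ℝ => Real.cos ((k : ℕ) * θ)) ∈ cosSpan (l + 1) :=
        Submodule.subset_span ⟨k, by omega, by omega, rfl⟩
      convert! Submodule.smul_mem _ (1 / 2 : ℝ) (Submodule.add_mem _ h1 h2) using 1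
      funext θ
      simp only [Pi.smul_apply, Pi.add_apply, smul_eq_mul]
      have e1 : ((k + 2 : ℕ) : ℝ) * θ = ((k + 1 : ℕ) : ℝ) * θ + θ := by push_cast; ring
      have e2 : ((k : ℕ) : ℝ) * θ = ((k + 1 : ℕ) : ℝ) * θ - θ := by push_cast; ring
      rw [e1, e2, Real.cos_add, Real.cos_sub]
      ring
  | zero =>
    convert! Submodule.zero_mem _ using 1
    funext θ; simp
  | add g h _ _ hg hh =>
    convert! Submodule.add_mem _ hg hh using 1
    funext θ; simp [mul_add]
  | smul a g _ hg =>
    convert! Submodule.smul_mem _ a hg using 1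
    funext θ; simp [mul_left_comm]

theorem zonalPoly_cos_mem_cosSpan (d l : ℕ) :
    (fun θ => (zonalPoly d l).eval (Real.cos θ)) ∈ cosSpan l := by
  induction l using Nat.twoStepInduction with
  | zero => exact Submodule.subset_span ⟨0, le_rfl, rfl, by funext θ; simp [zonalPoly]⟩
  | one => exact Submodule.subset_span ⟨1, le_rfl, rfl, by funext θ; simp [zonalPoly]⟩
  | more n h0 h1 =>
    convert! Submodule.smul_mem _ (1 / ((n : ℝ) + d)) (Submodule.sub_mem _
      (Submodule.smul_mem _ (2 * (n : ℝ) + 1 + d) (cos_mul_mem_cosSpan h1))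
      (Submodule.smul_mem _ ((n : ℝ) + 1) (cosSpan_le_add_two n h0))) using 1
    funext θ
    simp only [zonalPoly, Polynomial.eval_mul, Polynomial.eval_C, Polynomial.eval_sub,
      Polynomial.eval_X, Pi.smul_apply, Pi.sub_apply, smul_eq_mul]
    ring

/-- A geometric sum whose ratio is a 2M-th root of unity. The ratio is 1 only if k + M is a multiple
of 2M, that is, if k is an odd multiple of M; this forces k ≥ M and k ≡ M mod 2. -/
theorem sum_alternating_exp_eq_zero {M k : ℕ} (hM : 0 < M) (h : k < M ∨ k % 2 ≠ M % 2) :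
    ∑ j ∈ Finset.range (2 * M), (-Complex.exp (k * (Real.pi / M) * Complex.I)) ^ j = 0 := by
  have hM' : (M : ℂ) ≠ 0 := by exact_mod_cast hM.ne'
  set ω : ℂ := -Complex.exp (k * (Real.pi / M) * Complex.I) with hω
  have hpow : ω ^ (2 * M) = 1 := by
    rw [hω, Even.neg_pow (even_two_mul M), ← Complex.exp_nat_mul]
    rw [Complex.exp_eq_one_iff]
    refine ⟨k, ?_⟩
    push_cast
    field_simp
  have hne : ω ≠ 1 := by
    intro h1
    have h2 : Complex.exp (k * (Real.pi / M) * Complex.I + Real.pi * Complex.I) = 1 := by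
      have h3 : Complex.exp (k * (Real.pi / M) * Complex.I) = -1 := by
        rw [← neg_neg (Complex.exp _), ← hω, h1]
      rw [Complex.exp_add, Complex.exp_pi_mul_I, h3]; ring
    obtain ⟨n, hn⟩ := Complex.exp_eq_one_iff.1 h2
    have h3 : ((k : ℂ) + M) = n * (2 * M) := by
      have hpi : (Real.pi : ℂ) ≠ 0 := by exact_mod_cast Real.pi_ne_zero
      have h4 : ((Real.pi : ℂ) * Complex.I) ≠ 0 := mul_ne_zero hpi Complex.I_ne_zero
      apply mul_left_cancel₀ h4
      have h5 : (Real.pi : ℂ) * Complex.I * (k + M) =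
          M * (k * (Real.pi / M) * Complex.I + Real.pi * Complex.I) := by
        field_simp
      rw [h5, hn]; ring
    have h6 : (k : ℤ) + M = n * (2 * M) := by exact_mod_cast h3
    rcases h with h | h
    · have h7 : (0 : ℤ) < n := by
        by_contra hcon
        have : n * (2 * M) ≤ 0 := mul_nonpos_of_nonpos_of_nonneg (not_lt.1 hcon) (by positivity)
        omega
      have : (1 : ℤ) * (2 * M) ≤ n * (2 * M) := mul_le_mul_of_nonneg_right h7 (by positivity)
      omega
    · have h8 : n * (2 * M) = 2 * (n * M) := by ring
      rw [h8] at h6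
      omega
  have := mul_geom_sum ω (2 * M)
  rw [hpow, sub_self] at this
  exact (mul_eq_zero.1 this).resolve_left (sub_ne_zero.2 hne)

theorem sum_alternating_cos_sin_eq_zero {M k : ℕ} (hM : 0 < M) (h : k < M ∨ k % 2 ≠ M % 2) :
    ∑ j : Fin (2 * M), (-1) ^ (j : ℕ) * Real.cos (k * (j * (Real.pi / M))) = 0 ∧
    ∑ j : Fin (2 * M), (-1) ^ (j : ℕ) * Real.sin (k * (j * (Real.pi / M))) = 0 := by
  have h0 := sum_alternating_exp_eq_zero hM h
  have h1 : ∀ j : ℕ, (-Complex.exp (k * (Real.pi / M) * Complex.I)) ^ j =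
      (((-1) ^ j * Real.cos (k * (j * (Real.pi / M))) : ℝ) : ℂ) +
      (((-1) ^ j * Real.sin (k * (j * (Real.pi / M))) : ℝ) : ℂ) * Complex.I := by
    intro j
    rw [neg_pow, ← Complex.exp_nat_mul]
    have : (j : ℂ) * (k * (Real.pi / M) * Complex.I) =
        ((k * (j * (Real.pi / M)) : ℝ) : ℂ) * Complex.I := by push_cast; ring
    rw [this, Complex.exp_mul_I, ← Complex.ofReal_cos, ← Complex.ofReal_sin]
    push_cast
    ring
  simp only [h1, Finset.sum_add_distrib, ← Finset.sum_mul, ← Complex.ofReal_sum] at h0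
  have hre := congrArg Complex.re h0
  have him := congrArg Complex.im h0
  simp only [Complex.add_re, Complex.ofReal_re, Complex.re_ofReal_mul, Complex.I_re, mul_zero,
    add_zero, Complex.zero_re] at hre
  simp only [Complex.add_im, Complex.ofReal_im, Complex.im_ofReal_mul, Complex.I_im, mul_one,
    zero_add, Complex.zero_im] at him
  exact ⟨by rw [Finset.sum_range] at hre; exact hre, by rw [Finset.sum_range] at him; exact him⟩

/-- The alternating quadratic form over a regular `2M`-gon on a great circle annihilates the zonal
polynomials of degree less than `M`, and those of degree not congruent to `M` modulo `2`. -/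
theorem sum_alternating_zonalPoly_eq_zero {d : ℕ} {M l : ℕ} (hM : 0 < M)
    (h : l < M ∨ l % 2 ≠ M % 2) :
    ∑ i : Fin (2 * M), ∑ j : Fin (2 * M), (-1) ^ (i : ℕ) * (-1) ^ (j : ℕ) *
      (zonalPoly d l).eval (Real.cos (i * (Real.pi / M) - j * (Real.pi / M))) = 0 := by
  have key : ∀ g ∈ cosSpan l, ∑ i : Fin (2 * M), ∑ j : Fin (2 * M),
      (-1) ^ (i : ℕ) * (-1) ^ (j : ℕ) * g (i * (Real.pi / M) - j * (Real.pi / M)) = 0 := by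
    intro g hg
    induction hg using Submodule.span_induction with
    | mem g hg =>
      obtain ⟨k, hk, hk2, rfl⟩ := hg
      obtain ⟨hc, hs⟩ := sum_alternating_cos_sin_eq_zero (k := k) hM (by omega)
      have h1 : ∀ i j : Fin (2 * M), (-1) ^ (i : ℕ) * (-1) ^ (j : ℕ) *
          Real.cos (k * (i * (Real.pi / M) - j * (Real.pi / M))) =
          ((-1) ^ (i : ℕ) * Real.cos (k * (i * (Real.pi / M)))) *
            ((-1) ^ (j : ℕ) * Real.cos (k * (j * (Real.pi / M)))) +
          ((-1) ^ (i : ℕ) * Real.sin (k * (i * (Real.pi / M)))) *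
            ((-1) ^ (j : ℕ) * Real.sin (k * (j * (Real.pi / M)))) := by
        intro i j
        rw [mul_sub, Real.cos_sub]
        ring
      simp only [h1, Finset.sum_add_distrib, ← Finset.mul_sum, hc, hs, mul_zero,
        Finset.sum_const_zero, add_zero]
    | zero => simp
    | add g h _ _ hg hh =>
      simp only [Pi.add_apply, mul_add, Finset.sum_add_distrib, hg, hh, add_zero]
    | smul a g _ hg =>
      simp only [Pi.smul_apply, smul_eq_mul, mul_left_comm _ a, ← Finset.mul_sum, hg, mul_zero]
  exact key _ (zonalPoly_cos_mem_cosSpan d l)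

theorem circlePoint_polygon_injective {d : ℕ} (hd : 1 ≤ d) {M : ℕ} (hM : 0 < M) :
    Function.Injective fun j : Fin (2 * M) => circlePoint hd (j * (Real.pi / M)) := by
  intro i j hij
  have h1 : sphereDot (circlePoint hd (i * (Real.pi / M))) (circlePoint hd (j * (Real.pi / M)))
      = 1 := by
    have : circlePoint hd (i * (Real.pi / M)) = circlePoint hd (j * (Real.pi / M)) := hij
    rw [this, sphereDot_self]
  rw [sphereDot_circlePoint] at h1
  have hpi := Real.pi_pos
  have hM' : (0 : ℝ) < M := by exact_mod_cast hM
  have hstep : (2 * M : ℝ) * (Real.pi / M) = 2 * Real.pi := by field_simp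
  have hpos : 0 < Real.pi / M := by positivity
  have hlt : ∀ i : Fin (2 * M), (i : ℝ) * (Real.pi / M) < 2 * Real.pi := by
    intro i
    rw [← hstep]
    exact mul_lt_mul_of_pos_right (by exact_mod_cast i.2) hpos
  have hge : ∀ i : Fin (2 * M), 0 ≤ (i : ℝ) * (Real.pi / M) := fun i => by positivity
  rw [Real.cos_eq_one_iff_of_lt_of_lt (by linarith [hlt j, hge i]) (by linarith [hlt i, hge j])]
    at h1
  have h2 : (i : ℝ) = j := mul_right_cancel₀ hpos.ne' (sub_eq_zero.1 h1)
  exact Fin.ext (by exact_mod_cast h2)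

end Polygon

/-! ### Splitting the quadratic form by degree on S^m -/

theorem IsPSDKernel.of_hasSum {X I : Type*} {K : I → X → X → ℝ} {L : X → X → ℝ}
    (hK : ∀ i, IsPSDKernel (K i)) (h : ∀ x y, HasSum (fun i => K i x y) (L x y)) :
    IsPSDKernel L := by
  intro s c
  have h1 : HasSum (fun i => ∑ x ∈ s, ∑ y ∈ s, c x * c y * K i x y)
      (∑ x ∈ s, ∑ y ∈ s, c x * c y * L x y) :=
    hasSum_sum fun x _ => hasSum_sum fun y _ => (h x y).mul_left _
  exact h1.nonneg fun i => hK i s c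

theorem Finset.sum_sum_equivFin {X : Type*} (U : Finset X) (F : X → X → ℝ) :
    ∑ i, ∑ j, F (U.equivFin.symm i) (U.equivFin.symm j) = ∑ u ∈ U, ∑ v ∈ U, F u v := by
  rw [Equiv.sum_comp U.equivFin.symm fun u : U => ∑ j, F u (U.equivFin.symm j),
    Finset.sum_coe_sort U fun u => ∑ j, F u (U.equivFin.symm j)]
  refine Finset.sum_congr rfl fun u _ => ?_
  rw [Equiv.sum_comp U.equivFin.symm fun v : U => F u v, Finset.sum_coe_sort U fun v => F u v]

section Series

variable {m : ℕ} {f : ℝ → ℝ → ℝ} {a : ℕ → ℕ → ℝ}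

theorem eval_spherePoly (hm : 2 ≤ m) (l : ℕ) (t : ℝ) : (spherePoly m l).eval t =
    gegenbauerValue (((m : ℝ) - 1) / 2) l * (zonalPoly m l).eval t := by
  rw [spherePoly_eq hm, Polynomial.eval_mul, Polynomial.eval_C]

theorem eval_circlePoly (k : ℕ) (t : ℝ) :
    (circlePoly k).eval t = circleValue k * (zonalPoly 1 k).eval t := by
  rw [circlePoly_eq, Polynomial.eval_mul, Polynomial.eval_C]

theorem IsDoubleGegenbauerSeries.hasSum_circlePart (hm : 2 ≤ m)
    (ha : IsDoubleGegenbauerSeries m f a) (l : ℕ) {t : ℝ} (ht : t ∈ Set.Icc (-1 : ℝ) 1) :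
    HasSum (fun k => a k l * (circlePoly k).eval t) (circlePart a l t) := by
  have h1 := ha.2.1.comp_injective (i := fun k : ℕ => (k, l)) fun k k' h => (Prod.ext_iff.1 h).1
  have h2 : Summable fun k => a k l * circleValue k := by
    refine (h1.mul_left (gegenbauerValue (((m : ℝ) - 1) / 2) l)⁻¹).congr fun k => ?_
    have := (gegenbauerValue_sphere_pos hm l).ne'
    simp only [Function.comp, eval_spherePoly hm, eval_circlePoly, eval_one_zonalPoly le_rfl,
      eval_one_zonalPoly (show 1 ≤ m by omega)]
    field_simp
  refine (Summable.of_norm_bounded h2 fun k => ?_).hasSum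
  rw [eval_circlePoly, ← mul_assoc, norm_mul, Real.norm_of_nonneg
    (mul_nonneg (ha.1 k l) (circleValue_pos k).le)]
  exact mul_le_of_le_one_right (mul_nonneg (ha.1 k l) (circleValue_pos k).le)
    (abs_eval_zonalPoly_le_one le_rfl k ht)

theorem IsDoubleGegenbauerSeries.hasSum_levels (hm : 2 ≤ m)
    (ha : IsDoubleGegenbauerSeries m f a) {t s : ℝ} (ht : t ∈ Set.Icc (-1 : ℝ) 1)
    (hs : s ∈ Set.Icc (-1 : ℝ) 1) :
    HasSum (fun l => circlePart a l t * (spherePoly m l).eval s) (f t s) := by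
  have h := (Equiv.prodComm ℕ ℕ).hasSum_iff.2 (ha.2.2 t ht s hs)
  exact h.prod_fiberwise fun l => (ha.hasSum_circlePart hm l ht).mul_right _

theorem IsDoubleGegenbauerSeries.isPSDKernel_circlePart (hm : 2 ≤ m)
    (ha : IsDoubleGegenbauerSeries m f a) (l : ℕ) :
    IsPSDKernel fun x y : UnitSphere 1 => circlePart a l (sphereDot x y) := by
  refine IsPSDKernel.of_hasSum (K := fun k x y => a k l * (circlePoly k).eval (sphereDot x y))
    (fun k => ?_) fun x y => ha.hasSum_circlePart hm l (abs_le.1 (abs_sphereDot_le x y))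
  have h := (hasFeatures_zonalPoly (d := 1) le_rfl k).isPSDKernel.const_mul
    (mul_nonneg (ha.1 k l) (circleValue_pos k).le)
  simpa only [eval_circlePoly, mul_assoc] using h

/-- The contribution of degree `l` to the quadratic form of the kernel. -/
def levelForm (m : ℕ) (a : ℕ → ℕ → ℝ) {J : Type*} [Fintype J]
    (ξ : J → UnitSphere 1 × UnitSphere m) (c : J → ℝ) (l : ℕ) : ℝ :=
  ∑ i, ∑ j, c i * c j * (circlePart a l (sphereDot (ξ i).1 (ξ j).1) *
    (spherePoly m l).eval (sphereDot (ξ i).2 (ξ j).2))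

variable {J : Type*} [Fintype J] (ξ : J → UnitSphere 1 × UnitSphere m) (c : J → ℝ)

theorem IsDoubleGegenbauerSeries.hasSum_levelForm (hm : 2 ≤ m)
    (ha : IsDoubleGegenbauerSeries m f a) :
    HasSum (levelForm m a ξ c) (∑ i, ∑ j, c i * c j * circleSphereKernel m f (ξ i) (ξ j)) :=
  hasSum_sum fun _ _ => hasSum_sum fun _ _ =>
    (ha.hasSum_levels hm (abs_le.1 (abs_sphereDot_le _ _))
      (abs_le.1 (abs_sphereDot_le _ _))).mul_left _

theorem IsDoubleGegenbauerSeries.levelForm_nonneg (hm : 2 ≤ m)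
    (ha : IsDoubleGegenbauerSeries m f a) (l : ℕ) : 0 ≤ levelForm m a ξ c l := by
  have h1 : IsPSDKernel fun ξ η : UnitSphere 1 × UnitSphere m =>
      circlePart a l (sphereDot ξ.1 η.1) := fun s b =>
    (ha.isPSDKernel_circlePart hm l).sum_nonneg s Prod.fst b
  have h2 := (((hasFeatures_zonalPoly (show 1 ≤ m by omega) l).comp
    (Prod.snd : UnitSphere 1 × UnitSphere m → _)).isPSDKernel_mul h1).const_mul
    (gegenbauerValue_sphere_pos hm l).le
  refine (h2.sum_nonneg Finset.univ ξ c).trans_eq ?_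
  refine Finset.sum_congr rfl fun i _ => Finset.sum_congr rfl fun j _ => ?_
  rw [eval_spherePoly hm]
  ring

/-- The clause on a_{k,l} is automatic: if all a_{k,l} vanish for a given l, then f_l = 0 and the
form cannot be positive. -/
theorem mem_positiveLevels_iff (ha : IsDoubleGegenbauerSeries m f a) {p : ℕ}
    (x : Fin p → UnitSphere 1) (c : Fin p → ℝ) (l : ℕ) : l ∈ positiveLevels a x c ↔
      0 < ∑ i, ∑ j, c i * c j * circlePart a l (sphereDot (x i) (x j)) := by
  have h1 : c ⬝ᵥ (Matrix.of fun i j => circlePart a l (sphereDot (x i) (x j))).mulVec c =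
      ∑ i, ∑ j, c i * c j * circlePart a l (sphereDot (x i) (x j)) := by
    simp only [dotProduct, Matrix.mulVec, Matrix.of_apply, Finset.mul_sum]
    exact Finset.sum_congr rfl fun i _ => Finset.sum_congr rfl fun j _ => by ring
  rw [positiveLevels, Set.mem_ofPred_eq, h1, and_iff_right_iff_imp]
  intro hpos
  by_contra hcon
  push Not at hcon
  have hz : ∀ t, circlePart a l t = 0 := by
    intro t
    rw [circlePart]
    simp [fun k => le_antisymm (hcon k) (ha.1 k l)]
  simp [hz] at hpos

end Series

/-! ### Strict positivity forces infinitely many levels of each parity -/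

section Necessity

variable {m : ℕ} {f : ℝ → ℝ → ℝ} {a : ℕ → ℕ → ℝ}

theorem IsStrictlyPosDefKernel.sum_pos {X : Type*} {K : X → X → ℝ} (hK : IsStrictlyPosDefKernel K)
    {J : Type*} [Fintype J] {x : J → X} (hx : Function.Injective x) {c : J → ℝ} (hc : c ≠ 0) :
    0 < ∑ i, ∑ j, c i * c j * K (x i) (x j) := by
  obtain ⟨i₀, hi₀⟩ := Function.ne_iff.1 hc
  let e := Fintype.equivFin J
  have hpos : 0 < Fintype.card J := Fintype.card_pos_iff.2 ⟨i₀⟩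
  have h := hK.2 _ hpos (x ∘ e.symm) (hx.comp e.symm.injective) (c ∘ e.symm)
    (Function.ne_iff.2 ⟨e i₀, by simpa using hi₀⟩)
  rw [← Equiv.sum_comp e.symm]
  exact h.trans_eq (Finset.sum_congr rfl fun i _ =>
    Equiv.sum_comp e.symm fun j => c (e.symm i) * c j * K (x (e.symm i)) (x j))

/-- If the kernel is strictly positive definite, then every degree is exceeded by a positive level
of prescribed parity. -/
theorem IsDoubleGegenbauerSeries.exists_mem_positiveLevels (hm : 2 ≤ m)
    (ha : IsDoubleGegenbauerSeries m f a) (hK : IsStrictlyPosDefKernel (circleSphereKernel m f))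
    {p : ℕ} {x : Fin p → UnitSphere 1} (hx : Function.Injective x) {c : Fin p → ℝ} (hc : c ≠ 0)
    {M : ℕ} (hM : 0 < M) : ∃ l, M ≤ l ∧ l % 2 = M % 2 ∧ l ∈ positiveLevels a x c := by
  have hm1 : 1 ≤ m := by omega
  by_contra hcon
  push Not at hcon
  let z : Fin (2 * M) → UnitSphere m := fun j => circlePoint hm1 (j * (Real.pi / M))
  let ξ : Fin p × Fin (2 * M) → UnitSphere 1 × UnitSphere m := Prod.map x z
  let b : Fin p × Fin (2 * M) → ℝ := fun q => c q.1 * (-1) ^ (q.2 : ℕ)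
  have hξ : Function.Injective ξ := hx.prodMap (circlePoint_polygon_injective hm1 hM)
  have hb : b ≠ 0 := by
    obtain ⟨i, hi⟩ := Function.ne_iff.1 hc
    refine Function.ne_iff.2 ⟨(i, ⟨0, by omega⟩), ?_⟩
    simpa [b] using hi
  have hpos := hK.sum_pos hξ hb
  -- The polygon factor kills l < M and l of the wrong parity; for every other l, the assumed
  -- absence from the positive levels makes the circle factor 0.
  have hlevel : ∀ l, levelForm m a ξ b l = 0 := by
    intro l
    have hfac : levelForm m a ξ b l =
        (∑ i, ∑ j, c i * c j * circlePart a l (sphereDot (x i) (x j))) *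
        (gegenbauerValue (((m : ℝ) - 1) / 2) l *
          ∑ i : Fin (2 * M), ∑ j : Fin (2 * M), (-1) ^ (i : ℕ) * (-1) ^ (j : ℕ) *
            (zonalPoly m l).eval (Real.cos (i * (Real.pi / M) - j * (Real.pi / M)))) := by
      rw [levelForm, Fintype.sum_prod_type, Finset.sum_mul]
      refine Finset.sum_congr rfl fun i _ => ?_
      simp only [Fintype.sum_prod_type, Finset.mul_sum, Finset.sum_mul]
      refine Finset.sum_congr rfl fun i' _ => Finset.sum_comm.trans ?_
      refine Finset.sum_congr rfl fun j' _ => Finset.sum_congr rfl fun j _ => ?_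
      simp only [ξ, b, z, Prod.map, sphereDot_circlePoint, eval_spherePoly hm]
      ring
    rw [hfac]
    by_cases hl : l < M ∨ l % 2 ≠ M % 2
    · rw [sum_alternating_zonalPoly_eq_zero hM hl, mul_zero, mul_zero]
    · push Not at hl
      have h1 := hcon l hl.1 hl.2
      rw [mem_positiveLevels_iff ha, not_lt] at h1
      have h2 := (ha.isPSDKernel_circlePart hm l).sum_nonneg Finset.univ x c
      rw [le_antisymm h1 h2, zero_mul]
  have h := ha.hasSum_levelForm ξ b hm
  simp only [funext hlevel] at h
  exact hpos.ne' (h.unique hasSum_zero)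

end Necessity

/-! ### Positive levels of both parities force strict positivity -/

section Sufficiency

/-- Decay of Z_l fails at inner product ±1. Choosing one point per antipodal pair excludes -1
between distinct representatives, and the sign left over is handled by the parity of Z_l. -/
theorem exists_antipodal_representatives (m : ℕ) :
    ∃ (rep : UnitSphere m → UnitSphere m) (sgn : UnitSphere m → ℝ),
      (∀ z, sgn z = 1 ∨ sgn z = -1) ∧
      (∀ z w, sphereDot z w = sgn z * sgn w * sphereDot (rep z) (rep w)) ∧
      (∀ z w, rep z ≠ rep w → |sphereDot (rep z) (rep w)| < 1) ∧
      ∀ z w, rep z = rep w → sgn z = sgn w → z = w := by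
  classical
  let S : Setoid (UnitSphere m) :=
    { r := fun z w => z = w ∨ z = -w
      iseqv :=
        { refl := fun z => Or.inl rfl
          symm := by
            rintro z w (h | h)
            · exact Or.inl h.symm
            · exact Or.inr (by rw [h, neg_neg])
          trans := by
            rintro z w u (rfl | rfl) (rfl | rfl)
            · exact Or.inl rfl
            · exact Or.inr rfl
            · exact Or.inr rfl
            · exact Or.inl (neg_neg _) } }
  let rep : UnitSphere m → UnitSphere m := fun z => (Quotient.mk S z).out
  let sgn : UnitSphere m → ℝ := fun z => if z = rep z then 1 else -1
  have hrep : ∀ z, rep z = z ∨ rep z = -z := fun z => Quotient.mk_out (s := S) z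
  have hsgn : ∀ z, sgn z = 1 ∨ sgn z = -1 := fun z => by
    simp only [sgn]; split_ifs <;> simp
  have hval : ∀ z, z.1 = sgn z • (rep z).1 := by
    intro z
    simp only [sgn]
    split_ifs with h
    · rw [one_smul, ← h]
    · have h2 := (hrep z).resolve_left fun h' => h h'.symm
      rw [h2]; simp
  refine ⟨rep, sgn, hsgn, ?_, ?_, ?_⟩
  · intro z w
    simp only [sphereDot]
    conv_lhs => rw [hval z, hval w, real_inner_smul_left, real_inner_smul_right]
    ring
  · intro z w hne
    refine lt_of_le_of_ne (abs_sphereDot_le _ _) fun habs => hne ?_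
    have hnz : ‖(rep z).1‖ = 1 := norm_eq_of_mem_sphere _
    have hnw : ‖(rep w).1‖ = 1 := norm_eq_of_mem_sphere _
    have hout : rep z = rep w ∨ rep z = -rep w := by
      rcases eq_or_eq_neg_of_abs_eq habs with h | h
      · exact Or.inl (Subtype.ext ((inner_eq_one_iff_of_norm_eq_one hnz hnw).1 h))
      · refine Or.inr (Subtype.ext ((inner_eq_neg_one_iff_of_norm_eq_one hnz hnw).1 h))
    have hq : Quotient.mk S (rep z) = Quotient.mk S (rep w) := Quotient.sound hout
    simp only [rep, Quotient.out_eq] at hq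
    simp only [rep, hq]
  · intro z w h1 h2
    apply Subtype.ext
    rw [hval z, hval w, h1, h2]

theorem eval_zonalPoly_sign_mul {d : ℕ} (hd : 1 ≤ d) (n : ℕ) {σ : ℝ} (hσ : σ = 1 ∨ σ = -1)
    (t : ℝ) : (zonalPoly d n).eval (σ * t) = σ ^ n * (zonalPoly d n).eval t := by
  rcases hσ with rfl | rfl
  · simp
  · rw [neg_one_mul, eval_neg_zonalPoly hd]

/-- Diagonal dominance: a nearly diagonal kernel in the second variable controls
the diagonal blocks from below. -/
theorem IsPSDKernel.half_block_le {X R J : Type*} [DecidableEq R] [Fintype J] {F : X → X → ℝ}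
    (hF : IsPSDKernel F) (hsymm : ∀ x y, F x y = F y x) (x : J → X) (C : J → ℝ) (r : J → R)
    (G : R → R → ℝ) (hG : ∀ ρ, G ρ ρ = 1) {ε : ℝ} (hε0 : 0 ≤ ε)
    (hε : ε * (Finset.univ.image r).card ≤ 1 / 2)
    (hGε : ∀ ρ ∈ Finset.univ.image r, ∀ ρ' ∈ Finset.univ.image r, ρ ≠ ρ' → |G ρ ρ'| ≤ ε)
    {ρ₀ : R} (hρ₀ : ρ₀ ∈ Finset.univ.image r) :
    1 / 2 * (∑ i with r i = ρ₀, ∑ j with r j = ρ₀, C i * C j * F (x i) (x j)) ≤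
      ∑ i, ∑ j, C i * C j * (F (x i) (x j) * G (r i) (r j)) := by
  set T := Finset.univ.image r
  set β : R → R → ℝ := fun ρ ρ' =>
    ∑ i with r i = ρ, ∑ j with r j = ρ', C i * C j * F (x i) (x j)
  have hm : ∀ i ∈ (Finset.univ : Finset J), r i ∈ T := fun i hi => Finset.mem_image_of_mem r hi
  have hsum : ∑ i, ∑ j, C i * C j * (F (x i) (x j) * G (r i) (r j)) =
      ∑ ρ ∈ T, ∑ ρ' ∈ T, G ρ ρ' * β ρ ρ' := by
    rw [← Finset.sum_fiberwise_of_maps_to hm]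
    refine Finset.sum_congr rfl fun ρ _ => ?_
    rw [Finset.sum_congr rfl fun i _ => (Finset.sum_fiberwise_of_maps_to hm _).symm,
      Finset.sum_comm]
    refine Finset.sum_congr rfl fun ρ' _ => ?_
    rw [Finset.mul_sum]
    refine Finset.sum_congr rfl fun i hi => ?_
    rw [Finset.mul_sum]
    refine Finset.sum_congr rfl fun j hj => ?_
    rw [(Finset.mem_filter.1 hi).2, (Finset.mem_filter.1 hj).2]
    ring
  have hβ0 : ∀ ρ, 0 ≤ β ρ ρ := fun ρ => hF.sum_nonneg _ x C
  have hβsymm : ∀ ρ ρ', β ρ ρ' = β ρ' ρ := by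
    intro ρ ρ'
    simp only [β]
    rw [Finset.sum_comm]
    refine Finset.sum_congr rfl fun i _ => Finset.sum_congr rfl fun j _ => ?_
    rw [hsymm, mul_comm (C j)]
  -- The form of F is tested on block ρ plus σ times block ρ', with σ = 1 and σ = -1.
  have hβ : ∀ ρ ρ', |β ρ ρ'| ≤ (β ρ ρ + β ρ' ρ') / 2 := by
    intro ρ ρ'
    have hform : ∀ σ : ℝ, 0 ≤ β ρ ρ + 2 * σ * β ρ ρ' + σ ^ 2 * β ρ' ρ' := by
      intro σ
      have h := hF.sum_nonneg Finset.univ x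
        fun i => (if r i = ρ then C i else 0) + σ * (if r i = ρ' then C i else 0)
      have e : ∀ (u v : R), ∑ i, ∑ j, (if r i = u then C i else 0) * (if r j = v then C j else 0) *
          F (x i) (x j) = β u v := by
        intro u v
        simp only [β, Finset.sum_filter]
        refine Finset.sum_congr rfl fun i _ => ?_
        split_ifs with hi
        · refine Finset.sum_congr rfl fun j _ => ?_
          split_ifs <;> simp
        · simp
      have h2 : ∑ i, ∑ j, ((if r i = ρ then C i else 0) + σ * (if r i = ρ' then C i else 0)) *
          ((if r j = ρ then C j else 0) + σ * (if r j = ρ' then C j else 0)) * F (x i) (x j) =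
          β ρ ρ + σ * β ρ ρ' + σ * β ρ' ρ + σ ^ 2 * β ρ' ρ' := by
        rw [← e ρ ρ, ← e ρ ρ', ← e ρ' ρ, ← e ρ' ρ']
        simp only [Finset.mul_sum, ← Finset.sum_add_distrib]
        exact Finset.sum_congr rfl fun i _ => Finset.sum_congr rfl fun j _ => by ring
      rw [h2, hβsymm ρ' ρ] at h
      linarith
    have h1 := hform 1
    have h2 := hform (-1)
    rw [abs_le]
    constructor <;> linarith
  -- The ε term is also subtracted on the diagonal, where it is mere slack, so that the lower bounds
  -- sum to (1 - ε|T|) ∑ β ρ ρ.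
  have hterm : ∀ ρ ∈ T, ∀ ρ' ∈ T,
      (if ρ = ρ' then β ρ ρ else 0) - ε * ((β ρ ρ + β ρ' ρ') / 2) ≤ G ρ ρ' * β ρ ρ' := by
    intro ρ hρ ρ' hρ'
    split_ifs with h
    · subst h
      rw [hG, one_mul]
      nlinarith [hβ0 ρ]
    · have h1 : |G ρ ρ' * β ρ ρ'| ≤ ε * ((β ρ ρ + β ρ' ρ') / 2) := by
        rw [abs_mul]
        exact mul_le_mul (hGε ρ hρ ρ' hρ' h) (hβ ρ ρ') (abs_nonneg _) hε0
      linarith [neg_abs_le (G ρ ρ' * β ρ ρ')]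
  rw [hsum]
  have hlow : ∑ ρ ∈ T, ∑ ρ' ∈ T,
      ((if ρ = ρ' then β ρ ρ else 0) - ε * ((β ρ ρ + β ρ' ρ') / 2)) =
      (1 - ε * T.card) * ∑ ρ ∈ T, β ρ ρ := by
    simp only [Finset.sum_sub_distrib, ← Finset.mul_sum, ← Finset.sum_div, Finset.sum_add_distrib,
      Finset.sum_const, nsmul_eq_mul, Finset.sum_ite_eq]
    rw [Finset.sum_congr rfl fun ρ hρ => if_pos hρ]
    ring
  have hdiag : β ρ₀ ρ₀ ≤ ∑ ρ ∈ T, β ρ ρ :=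
    Finset.single_le_sum (f := fun ρ => β ρ ρ) (fun ρ _ => hβ0 ρ) hρ₀
  calc 1 / 2 * β ρ₀ ρ₀ ≤ (1 - ε * T.card) * ∑ ρ ∈ T, β ρ ρ :=
        mul_le_mul (by linarith) hdiag (hβ0 _) (by linarith)
    _ ≤ _ := by
        rw [← hlow]
        exact Finset.sum_le_sum fun ρ hρ => Finset.sum_le_sum fun ρ' hρ' => hterm ρ hρ ρ' hρ'

variable {m : ℕ} {f : ℝ → ℝ → ℝ} {a : ℕ → ℕ → ℝ}

theorem IsDoubleGegenbauerSeries.exists_levelForm_pos (hm : 2 ≤ m)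
    (ha : IsDoubleGegenbauerSeries m f a)
    (h : ∀ p : ℕ, 0 < p → ∀ x : Fin p → UnitSphere 1, Function.Injective x →
      ∀ c : Fin p → ℝ, c ≠ 0 →
        {l ∈ positiveLevels a x c | Even l}.Infinite ∧
        {l ∈ positiveLevels a x c | Odd l}.Infinite)
    {J : Type*} [Fintype J] {ξ : J → UnitSphere 1 × UnitSphere m} (hξ : Function.Injective ξ)
    {c : J → ℝ} (hc : c ≠ 0) : ∃ l, 0 < levelForm m a ξ c l := by
  classical
  have hm1 : 1 ≤ m := by omega
  obtain ⟨rep, sgn, hsgn, hdot, hlt, hinj⟩ := exists_antipodal_representatives m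
  obtain ⟨i₀, hi₀⟩ := Function.ne_iff.1 hc
  set r : J → UnitSphere m := fun i => rep (ξ i).2 with hr
  set T := Finset.univ.image r
  have hT : r i₀ ∈ T := Finset.mem_image_of_mem r (Finset.mem_univ _)
  have hTpos : (0 : ℝ) < T.card := by exact_mod_cast Finset.card_pos.2 ⟨_, hT⟩
  have hexε : ∀ N : ℝ, 0 < N → ∃ ε : ℝ, 0 < ε ∧ ε * N ≤ 1 / 2 := fun N hN =>
    ⟨1 / (2 * N), by positivity, le_of_eq (by field_simp)⟩
  obtain ⟨ε, hε, hεT⟩ := hexε _ hTpos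
  obtain ⟨L, hL⟩ : ∃ L, ∀ l, L ≤ l → ∀ ρ ∈ T, ∀ ρ' ∈ T, ρ ≠ ρ' →
      |(zonalPoly m l).eval (sphereDot ρ ρ')| ≤ ε := by
    rw [← eventually_atTop]
    refine (Filter.eventually_all_finset T).2 fun ρ hρ =>
      (Filter.eventually_all_finset T).2 fun ρ' hρ' => ?_
    obtain ⟨i, -, rfl⟩ := Finset.mem_image.1 hρ
    obtain ⟨j, -, rfl⟩ := Finset.mem_image.1 hρ'
    by_cases hij : r i = r j
    · exact Eventually.of_forall fun l hne => absurd hij hne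
    · have h1 := (tendsto_eval_zonalPoly hm (hlt _ _ hij)).abs
      rw [abs_zero] at h1
      filter_upwards [h1.eventually (gt_mem_nhds hε)] with l hl _ using hl.le
  have hbound : ∀ l, L ≤ l → gegenbauerValue (((m : ℝ) - 1) / 2) l * (1 / 2 *
      (∑ i with r i = r i₀, ∑ j with r j = r i₀, (c i * sgn (ξ i).2 ^ l) *
        (c j * sgn (ξ j).2 ^ l) * circlePart a l (sphereDot (ξ i).1 (ξ j).1))) ≤
      levelForm m a ξ c l := by
    intro l hl
    have h1 := (ha.isPSDKernel_circlePart hm l).half_block_le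
      (fun x y => by rw [sphereDot, sphereDot, real_inner_comm]) (fun i => (ξ i).1)
      (fun i => c i * sgn (ξ i).2 ^ l) r (fun ρ ρ' => (zonalPoly m l).eval (sphereDot ρ ρ'))
      (fun ρ => by rw [sphereDot_self, eval_one_zonalPoly hm1]) hε.le
      hεT (hL l hl) hT
    refine (mul_le_mul_of_nonneg_left h1 (gegenbauerValue_sphere_pos hm l).le).trans_eq ?_
    rw [levelForm, Finset.mul_sum]
    refine Finset.sum_congr rfl fun i _ => ?_
    rw [Finset.mul_sum]
    refine Finset.sum_congr rfl fun j _ => ?_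
    rw [eval_spherePoly hm, hdot (ξ i).2 (ξ j).2, mul_assoc (sgn _),
      eval_zonalPoly_sign_mul hm1 l (hsgn _), eval_zonalPoly_sign_mul hm1 l (hsgn _)]
    ring
  set s : Finset J := Finset.univ.filter fun i => r i = r i₀ with hs
  set U : Finset (UnitSphere 1) := s.image fun i => (ξ i).1
  have hi₀s : i₀ ∈ s := by simp [hs]
  have hx₀ : (ξ i₀).1 ∈ U := Finset.mem_image_of_mem (fun i => (ξ i).1) hi₀s
  set b : ℕ → UnitSphere 1 → ℝ := fun e u =>
    ∑ i ∈ s with (ξ i).1 = u, c i * sgn (ξ i).2 ^ e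
  -- Besides i₀, only the antipode of its second coordinate can share both its circle point and its
  -- representative. With the opposite sign it cancels in b 0 + sgn · b 1, which leaves 2 c i₀.
  have hb : b 0 (ξ i₀).1 ≠ 0 ∨ b 1 (ξ i₀).1 ≠ 0 := by
    by_contra hcon
    push Not at hcon
    have h1 : b 0 (ξ i₀).1 + sgn (ξ i₀).2 * b 1 (ξ i₀).1 = 2 * c i₀ := by
      simp only [b]
      rw [Finset.mul_sum, ← Finset.sum_add_distrib, Finset.sum_eq_single i₀]
      · rcases hsgn (ξ i₀).2 with h | h <;> rw [h] <;> ring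
      · intro i hi hne
        obtain ⟨hi1, hi2⟩ := Finset.mem_filter.1 hi
        have hri : r i = r i₀ := (Finset.mem_filter.1 hi1).2
        have hns : sgn (ξ i).2 ≠ sgn (ξ i₀).2 := fun hs' =>
          hne (hξ (Prod.ext hi2 (hinj _ _ hri hs')))
        rcases hsgn (ξ i).2 with h | h <;> rcases hsgn (ξ i₀).2 with h' | h' <;>
          first | exact absurd (h.trans h'.symm) hns | (rw [h, h']; ring)
      · intro hnot
        exact (hnot (Finset.mem_filter.2 ⟨hi₀s, rfl⟩)).elim
    rw [hcon.1, hcon.2] at h1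
    apply hi₀
    simp only [Pi.zero_apply]
    linarith
  -- Here e is the parity for which b e is nonzero. Hypothesis (ii) is applied to the distinct
  -- circle points U of the block with coefficients b e, and gives a level beyond the threshold L.
  have hfinal : ∀ e : ℕ, b e (ξ i₀).1 ≠ 0 → (∀ l, l % 2 = e → ∀ z, sgn z ^ l = sgn z ^ e) →
      (∀ x : Fin U.card → UnitSphere 1, Function.Injective x → ∀ c : Fin U.card → ℝ, c ≠ 0 →
        ∃ l, L ≤ l ∧ l % 2 = e ∧ l ∈ positiveLevels a x c) → ∃ l, 0 < levelForm m a ξ c l := by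
    intro e he hpow hex
    obtain ⟨l, hl, hle, hmem⟩ := hex (fun i => (U.equivFin.symm i : UnitSphere 1))
      (Subtype.val_injective.comp U.equivFin.symm.injective)
      (fun i => b e (U.equivFin.symm i))
      (Function.ne_iff.2 ⟨U.equivFin ⟨_, hx₀⟩, by simpa using he⟩)
    refine ⟨l, lt_of_lt_of_le ?_ (hbound l hl)⟩
    refine mul_pos (gegenbauerValue_sphere_pos hm l) (mul_pos (by norm_num) ?_)
    rw [mem_positiveLevels_iff ha] at hmem
    simp only [hpow l hle]
    rw [sum_sum_mul_eq_sum_image s (fun i => (ξ i).1) (fun i => c i * sgn (ξ i).2 ^ e)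
      (fun x y => circlePart a l (sphereDot x y))]
    rw [Finset.sum_sum_equivFin U fun u v =>
      b e u * b e v * circlePart a l (sphereDot u v)] at hmem
    exact hmem
  have hU : 0 < U.card := Finset.card_pos.2 ⟨_, hx₀⟩
  have hsq : ∀ z, sgn z ^ 2 = 1 := fun z => by rcases hsgn z with h | h <;> rw [h] <;> norm_num
  have hpow : ∀ l z, sgn z ^ l = sgn z ^ (l % 2) := by
    intro l z
    conv_lhs => rw [← Nat.div_add_mod l 2, pow_add, pow_mul, hsq, one_pow, one_mul]
  rcases hb with hb | hb
  · refine hfinal 0 hb (fun l hl z => by rw [hpow, hl]) fun x hx c hc => ?_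
    obtain ⟨l, hl, hlL⟩ := (h _ hU x hx c hc).1.exists_gt L
    exact ⟨l, hlL.le, Nat.even_iff.1 hl.2, hl.1⟩
  · refine hfinal 1 hb (fun l hl z => by rw [hpow, hl]) fun x hx c hc => ?_
    obtain ⟨l, hl, hlL⟩ := (h _ hU x hx c hc).2.exists_gt L
    exact ⟨l, hlL.le, Nat.odd_iff.1 hl.2, hl.1⟩

end Sufficiency

/-! ### The equivalence -/

theorem theorem3p9 (m : ℕ) (hm : 2 ≤ m) (f : ℝ → ℝ → ℝ)
    (hcont : ContinuousOn (fun q : ℝ × ℝ => f q.1 q.2)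
      (Set.Icc (-1 : ℝ) 1 ×ˢ Set.Icc (-1 : ℝ) 1))
    (hpd : IsPosDefKernel (circleSphereKernel m f)) :
    (∃ a : ℕ → ℕ → ℝ, IsDoubleGegenbauerSeries m f a) ∧
    ∀ a : ℕ → ℕ → ℝ, IsDoubleGegenbauerSeries m f a →
      (IsStrictlyPosDefKernel (circleSphereKernel m f) ↔
        ∀ p : ℕ, 0 < p → ∀ x : Fin p → UnitSphere 1, Function.Injective x →
          ∀ c : Fin p → ℝ, c ≠ 0 →
            {l ∈ positiveLevels a x c | Even l}.Infinite ∧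
            {l ∈ positiveLevels a x c | Odd l}.Infinite) := by
  refine ⟨exists_isDoubleGegenbauerSeries hm hcont hpd, fun a ha => ⟨?_, ?_⟩⟩
  · intro hK p _ x hx c hc
    constructor
    · refine Set.infinite_of_not_bddAbove ?_
      rintro ⟨B, hB⟩
      -- An even M exceeding the supposed bound B; the odd case below adds 1.
      obtain ⟨l, hl, hpar, hmem⟩ := ha.exists_mem_positiveLevels hm hK hx hc
        (M := 2 * (B + 1)) (by omega)
      have := hB ⟨hmem, Nat.even_iff.2 (by omega)⟩
      omega
    · refine Set.infinite_of_not_bddAbove ?_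
      rintro ⟨B, hB⟩
      obtain ⟨l, hl, hpar, hmem⟩ := ha.exists_mem_positiveLevels hm hK hx hc
        (M := 2 * (B + 1) + 1) (by omega)
      have := hB ⟨hmem, Nat.odd_iff.2 (by omega)⟩
      omega
  · intro h
    refine ⟨hpd, fun n _ ξ hξ c hc => ?_⟩
    -- One positive level suffices, because all the others are nonnegative.
    obtain ⟨l, hl⟩ := ha.exists_levelForm_pos hm h hξ hc
    exact hl.trans_le (le_hasSum (ha.hasSum_levelForm ξ c hm) l
      fun j _ => ha.levelForm_nonneg ξ c hm j)

end
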